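/- **Setting.** Let $p,K\in\mathbb N$, $N\ge 0$, and let $O_1,\dots,O_K\subseteq[p]$ be observation patterns with labelled sample sizes $n_1,\dots,n_K$, such that every $j\in[p]$ is observed at least once (it lies in some $O_k$ with $n_k\ge 1$). The data are independent: for each $k$, $n_k$ i.i.d. copies of $(X_{O_k},Y)$, and $N$ i.i.d. copies of $X$, where $(X,Y)\in\mathbb R^p\times\mathbb R$ satisfies $$Y=X^T\beta^*+\epsilon,\qquad \mathbb E[\epsilon\mid X]=0,\qquad \mathrm{Var}[\epsilon\mid X]=\sigma^2,\qquad \Sigma=\mathbb E[XX^T]\ \text{finite}.$$ Let $[p]=L_1\sqcup\dots\sqcup L_L$ be the partition into the smallest number $L$ of nonempty blocks (modalities) such that every $O_k$ is a union of blocks, and put $$h_l=\sum_{k:\,L_l\subseteq O_k}n_k,\qquad n_{g,h}=\sum_{k:\,L_g\cup L_h\subseteq O_k}n_k .$$ For a real random variable $Z$ let $\|Z\|_{\psi_2}=\inf\{c>0:\mathbb E e^{Z^2/c^2}\le 2\}$, and for a random vector let $\|X\|_{\psi_2}=\sup_{\|u\|_2=1}\|\langle u,X\rangle\|_{\psi_2}$.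 For $A\in\mathbb R^{p\times p}$ and $s\in\mathbb N$ let $$\phi^2(A,s)=\inf_{S\subseteq[p],\,|S|\le s}\ \inf_{\delta\ne 0,\ \|\delta_{S^c}\|_1\le\|\delta_S\|_1}\frac{\delta^TA\delta}{\|\delta_{M(\delta)}\|_2^2},\qquad M(\delta)=S\cup\{i\in S^c:|\delta_i|\ge|\delta_{S^c}|_{(\min\{s,|S^c|\})}\},$$ where $|\delta_{S^c}|_{(j)}$ is the $j$-th largest absolute value of the entries of $\delta_{S^c}$ and an infimum over the empty set is $+\infty$. For $R_X,R,B,\Phi_\Sigma>0$ let $\mathcal P_{HD}=\mathcal P_{HD}(R_X,R,B,s,\Phi_\Sigma)$ be the class of all such data-generating mechanisms with $\|X\|_{\psi_2}\le R_X$, $\mathbb E[X]=0$, $\mathbb E e^{t\epsilon}\le e^{\sigma^2t^2/2}$ for all $t\in\mathbb R$, $\phi^2(\Sigma,s)\ge\Phi_\Sigma$, $\|\beta^*\|_0\le s$, $\|\beta^*\|_2\le B$ and $0\le\sigma\le R$. Let $\hat\Theta_{HD}$ be the set of $\mathbb R^p$-valued functions $\hat\beta$ of the data such that $\|\hat\beta-\beta^*(P)\|_2$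 is measurable for every $P\in\mathcal P_{HD}$. **Theorem (blockwise-missing high-dimensional lower bound).** There is a universal constant $c_1>0$ such that the following holds. Suppose $\Phi_\Sigma\le\frac{3R_X^2}{16}$, $2\le s\le c_1\min_{l\in[L]}|L_l|$ with $s$ an integer, $n_{g,h}+N>0$ for all $g,h\in[L]$, and $$\max_{g,h}\frac{16\,s\log\!\big(1+\frac{|L_h|}{2(s-1)}\big)\min\{1,\frac{R^2}{B^2}\}\min\{1,\frac1{R_X^4}\}}{9\,(n_{g,h}+N)}\le 1,\qquad \max_{i\in[L]}\frac{R^2s\log\!\big(1+\frac{|L_i|}{2s}\big)}{16B^2\Phi_\Sigma h_i}\le 1 .$$ Then $$\inf_{\hat\beta\in\hat\Theta_{HD}}\sup_{P\in\mathcal P_{HD}}\mathbb E\big[\|\hat\beta-\beta^*(P)\|_2^2\big]\ \ge\ \max\left\{\max_{h\in[L]}\frac{\min\{1,\frac{2^6}{3^2R_X^4}\}\min\{B^2,R^2\}\,s\log\!\big(1+\frac{|L_h|}{2(s-1)}\big)}{2^{17}\min_{g\in[L]}\{n_{g,h}+N\}},\ \max_{l\in[L]}\frac{R^2s}{2^{10}h_l\Phi_\Sigma}\log\!\Big(1+\frac{|L_l|}{2s}\Big)\right\}.$$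 -/

import Mathlib

open MeasureTheory ProbabilityTheory
open scoped NNReal ENNReal

noncomputable section

namespace BlockMissing

/-! ### Missingness patterns and modalities -/

/-- A partition of `[p]` into `L` nonempty disjoint blocks such that every observation
pattern `O k` is a union of blocks. -/
structure IsCompatiblePartition {p K L : ℕ} (O : Fin K → Finset (Fin p))
    (block : Fin L → Finset (Fin p)) : Prop where
  nonempty : ∀ l, (block l).Nonempty
  disjoint : ∀ l m, l ≠ m → Disjoint (block l) (block m)
  cover : Finset.univ.biUnion block = Finset.univ
  union : ∀ k, ∃ T : Finset (Fin L), O k = T.biUnion block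

/-- The sampling design: `p` covariates, `K` missingness patterns, `n k` labelled observations in
which exactly the covariates in `O k` (and the response) are recorded, `N` unlabelled and fully
observed covariate vectors, and the partition of `[p]` into modalities, which is the compatible
partition with the smallest number `L` of blocks. -/
structure Design where
  p : ℕ
  K : ℕ
  L : ℕ
  N : ℕ
  O : Fin K → Finset (Fin p)
  n : Fin K → ℕ
  /-- Each variable is observed in at least one labelled observation. -/
  observed : ∀ j, ∃ k, j ∈ O k ∧ 0 < n k
  block : Fin L → Finset (Fin p)
  compatible : IsCompatiblePartition O block
  minimal : ∀ (m : ℕ) (other : Fin m → Finset (Fin p)), IsCompatiblePartition O other → L ≤ m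

/-- `h_l`: the number of labelled observations in which modality `l` is observed. -/
def Design.h (D : Design) (l : Fin D.L) : ℕ :=
  ∑ k, if D.block l ⊆ D.O k then D.n k else 0

/-- `n_{g,h}`: the number of labelled observations in which modalities `g` and `h` are both
observed. -/
def Design.crossN (D : Design) (g h : Fin D.L) : ℕ :=
  ∑ k, if D.block g ∪ D.block h ⊆ D.O k then D.n k else 0

/-! ### The linear model -/

/-- The noise `ε = Y - Xᵀ β` as a function of `(X, Y)`. -/
def noise {p : ℕ} (β : EuclideanSpace ℝ (Fin p)) (z : EuclideanSpace ℝ (Fin p) × ℝ) : ℝ :=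
  z.2 - ∑ j, z.1 j * β j

/-- A data-generating mechanism: a joint law of `(X, Y)` on `ℝ^p × ℝ` for which
`Y = Xᵀ β + ε` with `E[ε | X] = 0` and `Var[ε | X] = σ²`, where the covariates have finite
second moments. -/
structure Mechanism (p : ℕ) where
  law : Measure (EuclideanSpace ℝ (Fin p) × ℝ)
  isProb : IsProbabilityMeasure law
  /-- The regression coefficient. -/
  β : EuclideanSpace ℝ (Fin p)
  /-- The noise standard deviation. -/
  σ : ℝ≥0
  memLp_X : MemLp (fun z : EuclideanSpace ℝ (Fin p) × ℝ => z.1) 2 law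
  memLp_noise : MemLp (noise β) 2 law
  condMean : law[noise β | MeasurableSpace.comap Prod.fst inferInstance] =ᵐ[law] fun _ => 0
  condVariance : Var[noise β; law | MeasurableSpace.comap Prod.fst inferInstance]
    =ᵐ[law] fun _ => (σ : ℝ) ^ 2

/-- The second moment matrix `Σ = E[X Xᵀ]`. -/
def Mechanism.secondMoment {p : ℕ} (P : Mechanism p) : Matrix (Fin p) (Fin p) ℝ :=
  Matrix.of fun i j => ∫ z, z.1 i * z.1 j ∂P.law

/-! ### Sub-Gaussian norms and restricted eigenvalues -/

/-- The sub-Gaussian norm `inf {c > 0 : E exp (Z² / c²) ≤ 2}` of a real random variable, equal to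
`∞` if there is no such `c`. -/
def psi2Norm {Ω : Type*} [MeasurableSpace Ω] (Z : Ω → ℝ) (μ : Measure Ω) : ℝ≥0∞ :=
  ⨅ (c : ℝ≥0) (_ : 0 < c)
    (_ : ∫⁻ ω, ENNReal.ofReal (Real.exp (Z ω ^ 2 / (c : ℝ) ^ 2)) ∂μ ≤ 2), (c : ℝ≥0∞)

/-- The sub-Gaussian norm of a random vector: the supremum of the sub-Gaussian norms of its
one-dimensional projections in unit directions. -/
def psi2NormVec {Ω : Type*} [MeasurableSpace Ω] {p : ℕ} (X : Ω → EuclideanSpace ℝ (Fin p))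
    (μ : Measure Ω) : ℝ≥0∞ :=
  ⨆ (u : EuclideanSpace ℝ (Fin p)) (_ : ‖u‖ = 1), psi2Norm (fun ω => inner ℝ u (X ω)) μ

/-- The `j`-th largest value (`j = 1, 2, …, |T|`) of `|δ i|` over `i ∈ T`. -/
def kthLargestAbs {p : ℕ} (δ : Fin p → ℝ) (T : Finset (Fin p)) (j : ℕ) : ℝ :=
  ((T.val.map fun i => |δ i|).sort (· ≥ ·)).getD (j - 1) 0

/-- `M(δ) = S ∪ {i ∈ Sᶜ : |δ i| ≥ |δ_{Sᶜ}|_{(min (s, |Sᶜ|))}}`. -/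
def topSupport {p : ℕ} (δ : Fin p → ℝ) (S : Finset (Fin p)) (s : ℕ) : Finset (Fin p) :=
  S ∪ Sᶜ.filter fun i => kthLargestAbs δ Sᶜ (min s Sᶜ.card) ≤ |δ i|

/-- The restricted eigenvalue `φ²(A, s)`; it lives in `EReal` so that infima over empty sets
are `+∞`. -/
def restrictedEigenvalue {p : ℕ} (A : Matrix (Fin p) (Fin p) ℝ) (s : ℕ) : EReal :=
  ⨅ (S : Finset (Fin p)) (_ : S.card ≤ s) (δ : Fin p → ℝ) (_ : δ ≠ 0)
    (_ : ∑ i ∈ Sᶜ, |δ i| ≤ ∑ i ∈ S, |δ i|),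
    (((δ ⬝ᵥ A.mulVec δ) / ∑ i ∈ topSupport δ S s, δ i ^ 2 : ℝ) : EReal)

/-! ### The minimax risk -/

/-- The class `P_HD(R_X, R, B, s, Φ)` of high-dimensional mechanisms. -/
structure InHD {p : ℕ} (RX R B : ℝ) (s : ℕ) (Φ : ℝ) (P : Mechanism p) : Prop where
  subGaussian_X : psi2NormVec (fun z : EuclideanSpace ℝ (Fin p) × ℝ => z.1) P.law
    ≤ ENNReal.ofReal RX
  centred : ∀ j, ∫ z, z.1 j ∂P.law = 0
  /-- `E exp (t ε) ≤ exp (σ² t² / 2)` for all real `t`. -/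
  subGaussian_noise : HasSubgaussianMGF (noise P.β) (P.σ ^ 2) P.law
  restricted : (Φ : EReal) ≤ restrictedEigenvalue P.secondMoment s
  sparse : (Finset.univ.filter fun j => P.β j ≠ 0).card ≤ s
  norm_le : ‖P.β‖ ≤ B
  sd_le : (P.σ : ℝ) ≤ R

/-- The sample space: for each pattern `k`, `n k` copies of `(X_{O k}, Y)`, together with `N`
complete covariate vectors. -/
abbrev Design.Data (D : Design) : Type :=
  ((k : Fin D.K) → Fin (D.n k) → (D.O k → ℝ) × ℝ) × (Fin D.N → EuclideanSpace ℝ (Fin D.p))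

/-- The law of the data when all observations are independent, the labelled ones in pattern `k`
being distributed as `(X_{O k}, Y)` and the unlabelled ones as `X`. -/
def Design.dataLaw (D : Design) (P : Mechanism D.p) : Measure D.Data :=
  (Measure.pi fun k => Measure.pi fun _ : Fin (D.n k) =>
      P.law.map fun z => ((fun j : D.O k => z.1 j), z.2)).prod
    (Measure.pi fun _ : Fin D.N => P.law.map Prod.fst)

/-- The estimators `βhat` for which the loss `‖βhat - β(P)‖` is measurable for every `P` in the
class. -/
def Design.estimators (D : Design) (RX R B : ℝ) (s : ℕ) (Φ : ℝ) :
    Set (D.Data → EuclideanSpace ℝ (Fin D.p)) :=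
  {βhat | ∀ P : Mechanism D.p, InHD RX R B s Φ P → Measurable fun x => ‖βhat x - P.β‖}

/-- The minimax risk for the squared Euclidean loss. -/
def Design.minimaxRisk (D : Design) (RX R B : ℝ) (s : ℕ) (Φ : ℝ) : ℝ≥0∞ :=
  ⨅ βhat ∈ D.estimators RX R B s Φ, ⨆ (P : Mechanism D.p) (_ : InHD RX R B s Φ P),
    ∫⁻ x, ENNReal.ofReal (‖βhat x - P.β‖ ^ 2) ∂(D.dataLaw P)

end BlockMissing

end

/-! The bound comes from testing `m ^ q` Gaussian mechanisms, indexed by `f : Fin q → Fin m`,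
against one common dominating law. Each `f` picks one coordinate from each of `q` groups of size `m`
inside a modality and so defines a unit vector `u_f` (`sparseDir`); squared distances between these
vectors are proportional to Hamming distances.

Suppose that all data laws satisfy `P_f(A)² ≤ χ Q(A)` for a single probability measure `Q`. An
estimator with risk below `d² / 8` under every `P_f` comes within `d / 2` of the truth with
probability above `1 / 2`, so each of these success events has `Q`-probability above `1 / (4 χ)`. A
data point lies in success events only for `f` in a Hamming ball of radius below `q / 2`, hence in
at most `(2 √m) ^ q` of them. Summing over the `m ^ q` indices is contradictory as soon as `χ ≤ m ^
(q / 4)` and `m ≥ 4096` (`le_minimaxRisk_of_chiSqDominated`). No packing set and no mutual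
information is needed.

Chi-square constants multiply over independent observations (`ChiSqDominated.pi`), and an
observation whose law does not depend on `f` contributes the factor `1`. The two terms of the bound
come from two families in which only the right observations depend on `f`; the basic constant is
that of a correlated Gaussian coordinate (`chiSqDominated_spike`).

For the term with `h_l`, the covariates are isotropic with variance `Φ` and `β = d u_f` lives in
modality `l`. A pattern that misses `l` cannot distinguish the directions, because permuting unseen
coordinates preserves the Gaussian law, and unlabelled data carry no information on `β`.

For the term with `n_{g,h} + N`, a coordinate `j₀` of modality `g` has correlation `ρ` with the
projection on `u_f` in modality `h`, and `β = b (e_{j₀} - ρ u_f)`. The response then involves only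
the part of `X_{j₀}` that is independent of the other coordinates. A pattern without `j₀` therefore
sees nothing of `f`, and one without `h` is handled by permutation. What remains are the
observations containing both modalities and the unlabelled ones. -/

namespace BlockMissing

/-! ### Chi-square domination -/

section ChiSq

variable {α α' : Type*} [MeasurableSpace α] [MeasurableSpace α']

/-- `P` is dominated by `Q` with constant `c` in the chi-square sense:
`(∫ f dP)² ≤ c ∫ f² dQ` for all measurable `f ≥ 0`. For `P ≪ Q` the smallest such `c` is
`∫ (dP/dQ)² dQ`. -/
def ChiSqDominated (P Q : Measure α) (c : ℝ≥0∞) : Prop :=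
  ∀ f : α → ℝ≥0∞, Measurable f → (∫⁻ x, f x ∂P) ^ 2 ≤ c * ∫⁻ x, f x ^ 2 ∂Q

lemma sq_lintegral_mul_le (μ : Measure α) {f g : α → ℝ≥0∞} (hf : Measurable f)
    (hg : Measurable g) :
    (∫⁻ x, f x * g x ∂μ) ^ 2 ≤ (∫⁻ x, f x ^ 2 ∂μ) * ∫⁻ x, g x ^ 2 ∂μ := by
  have h := ENNReal.lintegral_mul_le_Lp_mul_Lq μ Real.HolderConjugate.two_two
    hf.aemeasurable hg.aemeasurable
  have h2 := pow_le_pow_left' h 2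
  simp only [Pi.mul_apply, ENNReal.rpow_two] at h2
  refine h2.trans (le_of_eq ?_)
  rw [mul_pow, ← ENNReal.rpow_two, ← ENNReal.rpow_two, ← ENNReal.rpow_mul, ← ENNReal.rpow_mul]
  norm_num

lemma ChiSqDominated.refl (P : Measure α) [IsProbabilityMeasure P] : ChiSqDominated P P 1 := by
  intro f hf
  simpa [mul_comm] using sq_lintegral_mul_le P hf (measurable_const (a := (1 : ℝ≥0∞)))

lemma ChiSqDominated.mono {P Q : Measure α} {c d : ℝ≥0∞} (h : ChiSqDominated P Q c)
    (hcd : c ≤ d) : ChiSqDominated P Q d := fun f hf =>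
  (h f hf).trans (mul_le_mul_left hcd _)

lemma ChiSqDominated.map {P Q : Measure α} {c : ℝ≥0∞} (h : ChiSqDominated P Q c) {g : α → α'}
    (hg : Measurable g) : ChiSqDominated (P.map g) (Q.map g) c := by
  intro f hf
  rw [lintegral_map hf hg, lintegral_map (hf.pow_const 2) hg]
  exact h _ (hf.comp hg)

/-- Tonelli: the first domination is applied to the integrated function, the second to each slice.
Phrasing domination through test functions avoids densities altogether. -/
lemma ChiSqDominated.prod {P Q : Measure α} {P' Q' : Measure α'} [SFinite P'] [SFinite Q']
    {c c' : ℝ≥0∞} (h : ChiSqDominated P Q c) (h' : ChiSqDominated P' Q' c') :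
    ChiSqDominated (P.prod P') (Q.prod Q') (c * c') := by
  intro f hf
  rw [lintegral_prod _ hf.aemeasurable, lintegral_prod _ (hf.pow_const 2).aemeasurable]
  calc (∫⁻ x, ∫⁻ y, f (x, y) ∂P' ∂P) ^ 2
      ≤ c * ∫⁻ x, (∫⁻ y, f (x, y) ∂P') ^ 2 ∂Q := h _ hf.lintegral_prod_right'
    _ ≤ c * ∫⁻ x, c' * ∫⁻ y, f (x, y) ^ 2 ∂Q' ∂Q := by
        gcongr with x
        exact h' _ (hf.comp measurable_prodMk_left)
    _ = c * c' * ∫⁻ x, ∫⁻ y, f (x, y) ^ 2 ∂Q' ∂Q := by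
        rw [lintegral_const_mul _ (hf.pow_const 2).lintegral_prod_right', mul_assoc]

lemma ChiSqDominated.pi : ∀ {n : ℕ} {β : Fin n → Type*} [∀ i, MeasurableSpace (β i)]
    {P Q : (i : Fin n) → Measure (β i)} [∀ i, IsProbabilityMeasure (P i)]
    [∀ i, IsProbabilityMeasure (Q i)] {c : Fin n → ℝ≥0∞}
    (_ : ∀ i, ChiSqDominated (P i) (Q i) (c i)),
    ChiSqDominated (Measure.pi P) (Measure.pi Q) (∏ i, c i) := by
  intro n
  induction n with
  | zero =>
    intro β _ P Q _ _ c h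
    have : Measure.pi P = Measure.pi Q := by
      rw [Measure.pi_of_empty, Measure.pi_of_empty]
    rw [this]
    simpa using ChiSqDominated.refl (Measure.pi Q)
  | succ n ih =>
    intro β _ P Q _ _ c h
    rw [← ((measurePreserving_piFinSuccAbove P 0).symm).map_eq,
      ← ((measurePreserving_piFinSuccAbove Q 0).symm).map_eq, Fin.prod_univ_succ]
    exact ((h 0).prod (ih fun i => h _)).map (MeasurableEquiv.measurable _)

lemma ChiSqDominated.measure_sq_le {P Q : Measure α} {c : ℝ≥0∞} (h : ChiSqDominated P Q c)
    {A : Set α} (hA : MeasurableSet A) : P A ^ 2 ≤ c * Q A := by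
  have := h (A.indicator 1) (measurable_one.indicator hA)
  rw [lintegral_indicator_one hA] at this
  refine this.trans (le_of_eq ?_)
  congr 1
  rw [← lintegral_indicator_one hA]
  refine lintegral_congr fun x => ?_
  by_cases hx : x ∈ A <;> simp [hx]

end ChiSq

/-! ### Minimax lower bound from a large family of hypotheses -/

/-- The sum over all functions `f` of `a` to the power of the Hamming distance between `f` and `f₀`. -/
lemma sum_pow_hammingDist {q m : ℕ} (a : ℝ) (f₀ : Fin q → Fin m) :
    ∑ f : Fin q → Fin m, a ^ hammingDist f f₀ = (1 + ((m : ℝ) - 1) * a) ^ q := by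
  have h1 : ∀ f : Fin q → Fin m, a ^ hammingDist f f₀ = ∏ i, if f i ≠ f₀ i then a else 1 := by
    intro f
    rw [Finset.prod_ite]
    simp [hammingDist]
  simp_rw [h1]
  have := (Finset.prod_univ_sum (fun _ : Fin q => (Finset.univ : Finset (Fin m)))
    (fun i j => if j ≠ f₀ i then a else (1 : ℝ))).symm
  rw [Fintype.piFinset_univ] at this
  rw [this]
  have h2 : ∀ i, ∑ j : Fin m, (if j ≠ f₀ i then a else (1 : ℝ)) = 1 + ((m : ℝ) - 1) * a := by
    intro i
    rw [← Finset.add_sum_erase _ _ (Finset.mem_univ (f₀ i)), Finset.sum_congr rfl (g := fun _ => a)]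
    · simp [Finset.card_erase_of_mem, Nat.cast_sub (show 1 ≤ m from (f₀ i).pos)]
    · intro j hj
      simp [Finset.ne_of_mem_erase hj]
  rw [Finset.prod_congr rfl fun i _ => h2 i]
  simp

/-- A Hamming ball of radius `q / 2` contains at most `2 ^ q * m ^ (q / 2)` functions. -/
lemma card_hammingDist_lt_half {q m : ℕ} (f₀ : Fin q → Fin m) :
    ((Finset.univ.filter fun f : Fin q → Fin m => 2 * hammingDist f f₀ < q).card : ℝ)
      ≤ (2 * √m) ^ q := by
  rcases Nat.eq_zero_or_pos q with rfl | hq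
  · simp
  have hm : 0 < m := (f₀ ⟨0, hq⟩).pos
  have hm' : (0 : ℝ) < √m := Real.sqrt_pos.2 (by exact_mod_cast hm)
  have hm1 : (1 : ℝ) ≤ √m := Real.one_le_sqrt.2 (by exact_mod_cast hm)
  -- Chernoff-type count with weight `1 / m` per disagreement: the generating function is at most `2
  -- ^ q`, while every member of the ball has weight at least `√m ^ (-q)`.
  have key : ∑ f : Fin q → Fin m, ((√m)⁻¹ ^ 2) ^ hammingDist f f₀ ≤ 2 ^ q := by
    rw [sum_pow_hammingDist]
    have hsq : (√(m : ℝ))⁻¹ ^ 2 = (m : ℝ)⁻¹ := by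
      rw [inv_pow, Real.sq_sqrt (by positivity)]
    rw [hsq]
    have h1 : (1 : ℝ) ≤ m := by exact_mod_cast hm
    have h0 : 0 ≤ (m : ℝ)⁻¹ := by positivity
    have h2 : (m : ℝ) * (m : ℝ)⁻¹ = 1 := mul_inv_cancel₀ (by positivity)
    gcongr
    nlinarith
  have h3 : ((Finset.univ.filter fun f : Fin q → Fin m => 2 * hammingDist f f₀ < q).card : ℝ)
      * ((√m)⁻¹) ^ q ≤ 2 ^ q := by
    refine le_trans ?_ key
    rw [← nsmul_eq_mul, ← Finset.sum_const]
    refine le_trans (Finset.sum_le_sum fun f hf => ?_)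
      (Finset.sum_le_sum_of_subset_of_nonneg (Finset.filter_subset _ _)
        fun f _ _ => by positivity)
    rw [← pow_mul]
    exact pow_le_pow_of_le_one (by positivity) (inv_le_one_of_one_le₀ hm1)
      (Finset.mem_filter.1 hf).2.le
  rw [inv_pow, ← div_eq_mul_inv, div_le_iff₀ (by positivity)] at h3
  rwa [mul_pow]

/-- The lower bound for the minimax risk given by `m ^ q` mechanisms which are indexed by the
functions `Fin q → Fin m` and have parameters separated in proportion to the Hamming distance, and
whose data laws are dominated by a common law. -/
theorem le_minimaxRisk_of_chiSqDominated (D : Design) {RX R B Φ : ℝ} {s : ℕ} {q m : ℕ}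
    (hq : 0 < q) (hm : 4096 ≤ m) (P : (Fin q → Fin m) → Mechanism D.p)
    (hP : ∀ f, InHD RX R B s Φ (P f)) [∀ f, IsProbabilityMeasure (D.dataLaw (P f))]
    (Q : Measure D.Data) [IsProbabilityMeasure Q] {χ : ℝ} (hχ : χ ≤ √m ^ ((q : ℝ) / 2))
    (hdom : ∀ f, ChiSqDominated (D.dataLaw (P f)) Q (ENNReal.ofReal χ)) {d : ℝ} (hd : 0 < d)
    (hβ : ∀ f f', d ^ 2 * (2 * hammingDist f f' / q) ≤ ‖(P f).β - (P f').β‖ ^ 2) :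
    ENNReal.ofReal (d ^ 2 / 8) ≤ D.minimaxRisk RX R B s Φ := by
  unfold Design.minimaxRisk
  refine le_iInf₂ fun βhat hβhat => ?_
  by_contra! hlt
  have hrisk : ∀ f, ∫⁻ x, ENNReal.ofReal (‖βhat x - (P f).β‖ ^ 2) ∂(D.dataLaw (P f))
      < ENNReal.ofReal (d ^ 2 / 8) := fun f =>
    (le_iSup₂_of_le (P f) (hP f) le_rfl).trans_lt hlt
  set A : (Fin q → Fin m) → Set D.Data := fun f => {x | ‖βhat x - (P f).β‖ < d / 2} with hA
  have hAm : ∀ f, MeasurableSet (A f) := fun f =>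
    measurableSet_lt (hβhat (P f) (hP f)) measurable_const
  -- Markov's inequality: failure with probability at least `1 / 2` would cost a risk of `(d² / 4) /
  -- 2`.
  have hPA : ∀ f, 2⁻¹ < D.dataLaw (P f) (A f) := by
    intro f
    by_contra! hle
    have hc : 2⁻¹ ≤ D.dataLaw (P f) (A f)ᶜ := by
      rw [prob_compl_eq_one_sub (hAm f)]
      refine ENNReal.le_sub_of_add_le_left (by finiteness) ?_
      calc _ ≤ (2⁻¹ : ℝ≥0∞) + 2⁻¹ := by gcongr
        _ = 1 := ENNReal.inv_two_add_inv_two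
    have h1 := mul_meas_ge_le_lintegral (μ := D.dataLaw (P f))
      (f := fun x => ENNReal.ofReal (‖βhat x - (P f).β‖ ^ 2))
      ((hβhat (P f) (hP f)).pow_const 2).ennreal_ofReal (ENNReal.ofReal (d ^ 2 / 4))
    have h2 : (A f)ᶜ ⊆ {x | ENNReal.ofReal (d ^ 2 / 4)
        ≤ ENNReal.ofReal (‖βhat x - (P f).β‖ ^ 2)} := by
      intro x hx
      simp only [hA, Set.mem_compl_iff, Set.mem_ofPred_eq, not_lt] at hx ⊢
      apply ENNReal.ofReal_le_ofReal
      nlinarith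
    have h3 : ENNReal.ofReal (d ^ 2 / 4) * 2⁻¹ ≤ ENNReal.ofReal (d ^ 2 / 4) *
      D.dataLaw (P f) {x | ENNReal.ofReal (d ^ 2 / 4)
        ≤ ENNReal.ofReal (‖βhat x - (P f).β‖ ^ 2)} := by
      gcongr
      exact hc.trans (measure_mono h2)
    have h4 : ENNReal.ofReal (d ^ 2 / 4) * 2⁻¹ = ENNReal.ofReal (d ^ 2 / 8) := by
      rw [show (2⁻¹ : ℝ≥0∞) = ENNReal.ofReal 2⁻¹ by
        rw [ENNReal.ofReal_inv_of_pos two_pos]; simp, ← ENNReal.ofReal_mul (by positivity)]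
      congr 1; ring
    exact absurd (hrisk f) (not_lt.2 (h4 ▸ (h3.trans h1)))
  have hQA : ∀ f, 1 < 4 * ENNReal.ofReal χ * Q (A f) := by
    intro f
    have h1 := (hdom f).measure_sq_le (hAm f)
    have h2 : (2⁻¹ : ℝ≥0∞) ^ 2 < D.dataLaw (P f) (A f) ^ 2 :=
      ENNReal.pow_lt_pow_left two_ne_zero (hPA f)
    have h3 := h2.trans_le h1
    have h4 : (4 : ℝ≥0∞) * (2⁻¹) ^ 2 < 4 * (ENNReal.ofReal χ * Q (A f)) :=
      (ENNReal.mul_lt_mul_iff_right (by norm_num) (by norm_num)).2 h3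
    have h5 : (4 : ℝ≥0∞) * (2⁻¹) ^ 2 = 1 := by
      rw [show (4 : ℝ≥0∞) = 2 ^ 2 by norm_num, ← mul_pow, ENNReal.mul_inv_cancel] <;> norm_num
    rw [h5, ← mul_assoc] at h4
    exact h4
  -- Two success events sharing a point have parameters closer than `d`, hence Hamming distance
  -- below `q / 2`.
  have hcount : ∀ x, ∑ f, (A f).indicator (1 : D.Data → ℝ≥0∞) x
      ≤ ENNReal.ofReal ((2 * √m) ^ q) := by
    intro x
    by_cases hx : ∃ f₀, x ∈ A f₀
    · obtain ⟨f₀, hf₀⟩ := hx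
      have hle : ∀ f, (A f).indicator (1 : D.Data → ℝ≥0∞) x
          ≤ if 2 * hammingDist f f₀ < q then 1 else 0 := by
        intro f
        by_cases hf : x ∈ A f
        · have : 2 * hammingDist f f₀ < q := by
            have h1 : ‖(P f).β - (P f₀).β‖ < d := by
              simp only [hA, Set.mem_ofPred_eq] at hf hf₀
              calc _ = ‖(βhat x - (P f₀).β) - (βhat x - (P f).β)‖ := by congr 1; abel
                _ ≤ _ := norm_sub_le _ _
                _ < d := by linarith
            have h2 := hβ f f₀
            have h3 : d ^ 2 * (2 * hammingDist f f₀ / q) < d ^ 2 * 1 := by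
              nlinarith [norm_nonneg ((P f).β - (P f₀).β)]
            have h4 := lt_of_mul_lt_mul_left h3 (by positivity)
            rw [div_lt_one (by exact_mod_cast hq)] at h4
            exact_mod_cast h4
          simp [hf, this]
        · simp [hf]
      refine (Finset.sum_le_sum fun f _ => hle f).trans ?_
      rw [← Finset.sum_filter]
      simp only [Finset.sum_const, nsmul_eq_mul, mul_one]
      rw [← ENNReal.ofReal_natCast]
      exact ENNReal.ofReal_le_ofReal (card_hammingDist_lt_half f₀)
    · push Not at hx
      simp [hx]
  have hsum : ∑ f, Q (A f) ≤ ENNReal.ofReal ((2 * √m) ^ q) := by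
    calc ∑ f, Q (A f) = ∫⁻ x, ∑ f, (A f).indicator 1 x ∂Q := by
          rw [lintegral_finsetSum _ fun f _ => measurable_one.indicator (hAm f)]
          simp [lintegral_indicator_one (hAm _)]
      _ ≤ ∫⁻ _, ENNReal.ofReal ((2 * √m) ^ q) ∂Q := lintegral_mono hcount
      _ = _ := by simp
  have hm0 : (64 : ℝ) ≤ √m := by
    apply Real.le_sqrt_of_sq_le
    have : (4096 : ℝ) ≤ m := by exact_mod_cast hm
    linarith
  have hpos : (0 : ℝ) < √m := by linarith
  have hbig : ENNReal.ofReal ((m : ℝ) ^ q) < 4 * ENNReal.ofReal χ * ENNReal.ofReal ((2 * √m) ^ q) := by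
    calc ENNReal.ofReal ((m : ℝ) ^ q) = ∑ f : Fin q → Fin m, 1 := by
          simp [ENNReal.ofReal_pow]
      _ < ∑ f, 4 * ENNReal.ofReal χ * Q (A f) :=
          ENNReal.sum_lt_sum_of_nonempty ⟨fun _ => ⟨0, by omega⟩, Finset.mem_univ _⟩
            fun f _ => hQA f
      _ = 4 * ENNReal.ofReal χ * ∑ f, Q (A f) := by rw [Finset.mul_sum]
      _ ≤ _ := by gcongr
  -- This is where `4096` enters: `4 · 2 ^ q ≤ 8 ^ q ≤ √m ^ (q / 2)` uses `√m ≥ 64 = 8²`.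
  have hfin : 4 * χ * (2 * √m) ^ q ≤ (m : ℝ) ^ q := by
    have e1 : (m : ℝ) ^ q = √m ^ q * √m ^ q := by
      rw [← mul_pow, Real.mul_self_sqrt (by positivity)]
    have e2 : √(m : ℝ) ^ q = √m ^ ((q : ℝ) / 2) * √m ^ ((q : ℝ) / 2) := by
      rw [← Real.rpow_add hpos, ← Real.rpow_natCast]; congr 1; ring
    have e3 : (8 : ℝ) ^ q ≤ √m ^ ((q : ℝ) / 2) := by
      have : (8 : ℝ) ^ q = 64 ^ ((q : ℝ) / 2) := by
        rw [show (64 : ℝ) = 8 ^ (2 : ℝ) by norm_num, ← Real.rpow_mul (by norm_num),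
          ← Real.rpow_natCast]
        congr 1; ring
      rw [this]
      exact Real.rpow_le_rpow (by norm_num) hm0 (by positivity)
    have e4 : (4 : ℝ) * 2 ^ q ≤ 8 ^ q := by
      rw [show (8 : ℝ) = 4 * 2 by norm_num, mul_pow]
      gcongr
      exact le_self_pow₀ (by norm_num) (by omega)
    set a := √(m : ℝ) ^ ((q : ℝ) / 2)
    have ha : 0 < a := Real.rpow_pos_of_pos hpos _
    rw [e1, mul_pow]
    calc 4 * χ * (2 ^ q * √m ^ q) ≤ 4 * a * (2 ^ q * √m ^ q) := by gcongr
      _ = (4 * 2 ^ q) * a * √m ^ q := by ring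
      _ ≤ a * a * √m ^ q := by gcongr; exact e4.trans e3
      _ = _ := by rw [← e2]
  rw [show (4 : ℝ≥0∞) = ENNReal.ofReal 4 by simp, ← ENNReal.ofReal_mul (by norm_num),
    ← ENNReal.ofReal_mul' (by positivity)] at hbig
  exact absurd hbig (not_lt.2 (ENNReal.ofReal_le_ofReal hfin))

/-! ### Gaussian computations -/

lemma lintegral_exp_neg_mul_sub_sq {a : ℝ} (ha : 0 < a) (b : ℝ) :
    ∫⁻ t : ℝ, ENNReal.ofReal (Real.exp (-a * (t - b) ^ 2)) = ENNReal.ofReal √(Real.pi / a) := by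
  rw [lintegral_sub_right_eq_self (fun t : ℝ => ENNReal.ofReal (Real.exp (-a * t ^ 2))) b,
    ← ofReal_integral_eq_lintegral_ofReal (integrable_exp_neg_mul_sq ha)
      (Filter.Eventually.of_forall fun _ => (Real.exp_pos _).le), integral_gaussian]

lemma lintegral_exp_mul_sq_gaussianReal (v : ℝ≥0) {c : ℝ} (h : 2 * c * v < 1) :
    ∫⁻ x, ENNReal.ofReal (Real.exp (c * x ^ 2)) ∂gaussianReal 0 v
      = ENNReal.ofReal (√(1 - 2 * c * v))⁻¹ := by
  by_cases hv : v = 0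
  · subst hv
    simp [gaussianReal_zero_var]
  have hv' : (0 : ℝ) < v := by positivity
  have ha : 0 < (1 - 2 * c * v) / (2 * v) := div_pos (by linarith) (by positivity)
  rw [gaussianReal_of_var_ne_zero _ hv, lintegral_withDensity_eq_lintegral_mul _
    (measurable_gaussianPDF 0 v) (by fun_prop)]
  have : ∀ x : ℝ, (gaussianPDF 0 v * fun x : ℝ => ENNReal.ofReal (Real.exp (c * x ^ 2))) x
      = ENNReal.ofReal (√(2 * Real.pi * v))⁻¹ *
        ENNReal.ofReal (Real.exp (-((1 - 2 * c * v) / (2 * v)) * (x - 0) ^ 2)) := by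
    intro x
    simp only [Pi.mul_apply, gaussianPDF, gaussianPDFReal]
    rw [← ENNReal.ofReal_mul (by positivity), ← ENNReal.ofReal_mul (by positivity), mul_assoc,
      ← Real.exp_add]
    congr 3
    field_simp
    ring
  rw [lintegral_congr this, lintegral_const_mul _ (by fun_prop), lintegral_exp_neg_mul_sub_sq ha,
    ← ENNReal.ofReal_mul (by positivity), ← Real.sqrt_inv, ← Real.sqrt_mul (by positivity),
    ← Real.sqrt_inv]
  congr 2
  have : 1 - 2 * c * v ≠ 0 := by linarith
  field_simp

/-- The density of `N(m, w²)` with respect to `N(0, 1)`. -/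
noncomputable def gaussianRatio (w m t : ℝ) : ℝ :=
  w⁻¹ * Real.exp (-(t - m) ^ 2 / (2 * w ^ 2) + t ^ 2 / 2)

lemma measurable_gaussianRatio (w : ℝ) :
    Measurable fun p : ℝ × ℝ => gaussianRatio w p.1 p.2 := by
  unfold gaussianRatio
  fun_prop

lemma lintegral_affine_gaussianReal {w : ℝ} (hw : 0 < w) (m : ℝ) {f : ℝ → ℝ≥0∞}
    (hf : Measurable f) :
    ∫⁻ x, f (m + w * x) ∂gaussianReal 0 1
      = ∫⁻ t, f t * ENNReal.ofReal (gaussianRatio w m t) ∂gaussianReal 0 1 := by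
  have h1 : (gaussianReal 0 1).map (fun x => m + w * x)
      = gaussianReal m (NNReal.mk (w ^ 2) (sq_nonneg w)) := by
    rw [show (fun x => m + w * x) = (fun x => m + x) ∘ (fun x => w * x) from rfl,
      ← Measure.map_map (by fun_prop) (by fun_prop), gaussianReal_map_const_mul,
      gaussianReal_map_const_add]
    simp
  have hv : (NNReal.mk (w ^ 2) (sq_nonneg w)) ≠ 0 := by
    intro h
    have := congrArg NNReal.toReal h
    simp [hw.ne'] at this
  have hm : Measurable fun t => ENNReal.ofReal (gaussianRatio w m t) :=
    ((measurable_gaussianRatio w).comp measurable_prodMk_left).ennreal_ofReal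
  rw [← lintegral_map hf (by fun_prop : Measurable fun x => m + w * x), h1,
    gaussianReal_of_var_ne_zero _ hv, gaussianReal_of_var_ne_zero _ one_ne_zero,
    lintegral_withDensity_eq_lintegral_mul _ (measurable_gaussianPDF _ _) hf,
    lintegral_withDensity_eq_lintegral_mul _ (measurable_gaussianPDF _ _)
      (show Measurable fun t => f t * ENNReal.ofReal (gaussianRatio w m t) from hf.mul hm)]
  refine lintegral_congr fun t => ?_
  have : gaussianPDF m (NNReal.mk (w ^ 2) (sq_nonneg w)) t
      = gaussianPDF 0 1 t * ENNReal.ofReal (gaussianRatio w m t) := by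
    simp only [gaussianPDF, gaussianPDFReal, gaussianRatio]
    rw [← ENNReal.ofReal_mul (by positivity)]
    congr 1
    simp only [NNReal.coe_mk, NNReal.coe_one, mul_one, sub_zero]
    rw [Real.sqrt_mul (by positivity), Real.sqrt_sq hw.le, mul_inv]
    rw [show -t ^ 2 / 2 = -(t ^ 2 / 2) by ring, Real.exp_add, Real.exp_neg (t ^ 2 / 2)]
    field_simp
  simp only [Pi.mul_apply, this]
  ring

/-- Completing the square in `t` leaves a Gaussian integral centred at `2 m / (2 - w²)`; it
converges because `w² < 2`. -/
lemma lintegral_gaussianRatio_sq {w : ℝ} (hw : 0 < w) (hw2 : w ^ 2 < 2) (m : ℝ) :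
    ∫⁻ t, ENNReal.ofReal (gaussianRatio w m t) ^ 2 ∂gaussianReal 0 1
      = ENNReal.ofReal ((w * √(2 - w ^ 2))⁻¹ * Real.exp (m ^ 2 / (2 - w ^ 2))) := by
  have h2 : 0 < 2 - w ^ 2 := by linarith
  have ha : 0 < (2 - w ^ 2) / (2 * w ^ 2) := by positivity
  have hm : Measurable fun t => ENNReal.ofReal (gaussianRatio w m t) :=
    ((measurable_gaussianRatio w).comp measurable_prodMk_left).ennreal_ofReal
  rw [gaussianReal_of_var_ne_zero _ one_ne_zero,
    lintegral_withDensity_eq_lintegral_mul _ (measurable_gaussianPDF _ _) (hm.pow_const 2)]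
  have : ∀ t : ℝ, (gaussianPDF 0 1 * fun t : ℝ => ENNReal.ofReal (gaussianRatio w m t) ^ 2) t
      = ENNReal.ofReal ((√(2 * Real.pi))⁻¹ * (w ^ 2)⁻¹ * Real.exp (m ^ 2 / (2 - w ^ 2))) *
        ENNReal.ofReal (Real.exp (-((2 - w ^ 2) / (2 * w ^ 2)) *
          (t - 2 * m / (2 - w ^ 2)) ^ 2)) := by
    intro t
    have hr : 0 ≤ gaussianRatio w m t := by unfold gaussianRatio; positivity
    simp only [Pi.mul_apply, gaussianPDF, gaussianPDFReal]
    rw [← ENNReal.ofReal_pow hr, ← ENNReal.ofReal_mul (by positivity),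
      ← ENNReal.ofReal_mul (by positivity)]
    congr 1
    simp only [gaussianRatio, NNReal.coe_one, mul_one, sub_zero, mul_pow, ← Real.exp_nat_mul]
    have e : Real.exp (-t ^ 2 / 2) *
        Real.exp (((2 : ℕ) : ℝ) * (-(t - m) ^ 2 / (2 * w ^ 2) + t ^ 2 / 2))
        = Real.exp (m ^ 2 / (2 - w ^ 2)) * Real.exp (-((2 - w ^ 2) / (2 * w ^ 2)) *
          (t - 2 * m / (2 - w ^ 2)) ^ 2) := by
      rw [← Real.exp_add, ← Real.exp_add]
      congr 1
      push_cast
      field_simp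
      ring
    rw [inv_pow]
    linear_combination ((√(2 * Real.pi))⁻¹ * (w ^ 2)⁻¹) * e
  rw [lintegral_congr this, lintegral_const_mul _ (by fun_prop), lintegral_exp_neg_mul_sub_sq ha,
    ← ENNReal.ofReal_mul (by positivity)]
  congr 1
  have e : √(Real.pi / ((2 - w ^ 2) / (2 * w ^ 2))) = √(2 * Real.pi) * w / √(2 - w ^ 2) := by
    rw [show Real.pi / ((2 - w ^ 2) / (2 * w ^ 2)) = (2 * Real.pi) * w ^ 2 / (2 - w ^ 2) by
      field_simp, Real.sqrt_div (by positivity), Real.sqrt_mul (by positivity),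
      Real.sqrt_sq hw.le]
  rw [e]
  have := Real.sqrt_pos.2 h2
  field_simp

section Euclidean

variable {E : Type*} [NormedAddCommGroup E] [InnerProductSpace ℝ E] [FiniteDimensional ℝ E]
  [MeasurableSpace E] [BorelSpace E]

lemma stdGaussian_map_inner (a : E) :
    (stdGaussian E).map (fun z => inner ℝ a z) = gaussianReal 0 (‖a‖₊ ^ 2) := by
  have h := IsGaussian.map_eq_gaussianReal (μ := stdGaussian E) (innerSL ℝ a)
  rw [variance_dual_stdGaussian, integral_strongDual_stdGaussian, innerSL_apply_norm] at h
  have e : (‖a‖ ^ 2).toNNReal = ‖a‖₊ ^ 2 := by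
    rw [← coe_nnnorm, ← NNReal.coe_pow, Real.toNNReal_coe]
  rw [e] at h
  exact h

lemma stdGaussian_prod_map_inner_add (a : E) (c : ℝ) :
    ((stdGaussian E).prod (gaussianReal 0 1)).map (fun p => inner ℝ a p.1 + c * p.2)
      = gaussianReal 0 (‖a‖₊ ^ 2 + ‖c‖₊ ^ 2) := by
  have h1 : ((stdGaussian E).prod (gaussianReal 0 1)).map (fun p => inner ℝ a p.1)
      = gaussianReal 0 (‖a‖₊ ^ 2) := by
    rw [show (fun p : E × ℝ => inner ℝ a p.1) = (fun z => inner ℝ a z) ∘ Prod.fst from rfl,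
      ← Measure.map_map (by fun_prop) measurable_fst]
    simp [Measure.map_fst_prod, stdGaussian_map_inner]
  have h2 : ((stdGaussian E).prod (gaussianReal 0 1)).map (fun p => c * p.2)
      = gaussianReal 0 (‖c‖₊ ^ 2) := by
    rw [show (fun p : E × ℝ => c * p.2) = (fun z => c * z) ∘ Prod.snd from rfl,
      ← Measure.map_map (by fun_prop) measurable_snd]
    simp only [Measure.map_snd_prod, measure_univ, one_smul, gaussianReal_map_const_mul, mul_zero,
      mul_one]
    congr 1
    ext; simp
  have h3 : IndepFun (fun p : E × ℝ => inner ℝ a p.1) (fun p : E × ℝ => c * p.2)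
      ((stdGaussian E).prod (gaussianReal 0 1)) :=
    indepFun_prod (X := fun z => inner ℝ a z) (Y := fun z => c * z) (by fun_prop) (by fun_prop)
  have := gaussianReal_add_gaussianReal_of_indepFun h3 h1 h2
  simp only [add_zero] at this
  exact this

/-- Adding to an independent standard Gaussian coordinate a correlation `r` with the projection of
a standard Gaussian vector in a unit direction. -/
theorem chiSqDominated_spike {u : E} (hu : ‖u‖ = 1) {r w : ℝ} (hw : 0 < w)
    (hrw : r ^ 2 + w ^ 2 = 1) :
    ChiSqDominated
      (((stdGaussian E).prod (gaussianReal 0 1)).map fun p => (p.1, r * inner ℝ u p.1 + w * p.2))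
      ((stdGaussian E).prod (gaussianReal 0 1)) (ENNReal.ofReal (w ^ 2)⁻¹) := by
  intro f hf
  have hwm : Measurable fun p : E × ℝ =>
      ENNReal.ofReal (gaussianRatio w (r * inner ℝ u p.1) p.2) :=
    ((measurable_gaussianRatio w).comp
      (by fun_prop : Measurable fun p : E × ℝ => (r * inner ℝ u p.1, p.2))).ennreal_ofReal
  have h1 : ∫⁻ p, f p ∂(((stdGaussian E).prod (gaussianReal 0 1)).map
        fun p => (p.1, r * inner ℝ u p.1 + w * p.2))
      = ∫⁻ p, f p * ENNReal.ofReal (gaussianRatio w (r * inner ℝ u p.1) p.2)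
        ∂((stdGaussian E).prod (gaussianReal 0 1)) := by
    rw [lintegral_map hf (by fun_prop), lintegral_prod _ (by fun_prop),
      lintegral_prod (fun p => f p * _) (hf.mul hwm).aemeasurable]
    refine lintegral_congr fun z => ?_
    exact lintegral_affine_gaussianReal hw (r * inner ℝ u z) (f := fun t => f (z, t))
      (hf.comp measurable_prodMk_left)
  -- Integrating first over the last coordinate leaves an exponential of a squared standard
  -- Gaussian. Since `2 - w² - 2 r² = w²`, the two square-root factors combine to exactly `1 / w²`.
  have h2 : ∫⁻ p : E × ℝ, ENNReal.ofReal (gaussianRatio w (r * inner ℝ u p.1) p.2) ^ 2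
        ∂((stdGaussian E).prod (gaussianReal 0 1)) = ENNReal.ofReal (w ^ 2)⁻¹ := by
    have hw2 : w ^ 2 < 2 := by nlinarith
    have h2w : 0 < 2 - w ^ 2 := by linarith
    rw [lintegral_prod _ (hwm.pow_const 2).aemeasurable]
    simp_rw [lintegral_gaussianRatio_sq hw hw2]
    have e : ∀ z : E, ENNReal.ofReal ((w * √(2 - w ^ 2))⁻¹ *
        Real.exp ((r * inner ℝ u z) ^ 2 / (2 - w ^ 2)))
        = ENNReal.ofReal (w * √(2 - w ^ 2))⁻¹ *
          (fun x : ℝ => ENNReal.ofReal (Real.exp (r ^ 2 / (2 - w ^ 2) * x ^ 2))) (inner ℝ u z) := by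
      intro z
      rw [← ENNReal.ofReal_mul (by positivity)]
      congr 3
      ring
    have hu' : ‖u‖₊ = 1 := by ext; simpa using hu
    have hs : 0 < √(2 - w ^ 2) := Real.sqrt_pos.2 h2w
    rw [lintegral_congr e, lintegral_const_mul _ (by fun_prop),
      ← lintegral_map (f := fun x : ℝ => ENNReal.ofReal (Real.exp (r ^ 2 / (2 - w ^ 2) * x ^ 2)))
        (by fun_prop) (by fun_prop), stdGaussian_map_inner, hu', one_pow,
      lintegral_exp_mul_sq_gaussianReal, ← ENNReal.ofReal_mul (by positivity)]
    · congr 1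
      rw [show 1 - 2 * (r ^ 2 / (2 - w ^ 2)) * ((1 : ℝ≥0) : ℝ) = w ^ 2 / (2 - w ^ 2) by
        rw [show r ^ 2 = 1 - w ^ 2 by linarith]; field_simp; simp; ring,
        Real.sqrt_div (by positivity), Real.sqrt_sq hw.le]
      field_simp
    · rw [show r ^ 2 = 1 - w ^ 2 by linarith]
      have hw0 := pow_pos hw 2
      rw [NNReal.coe_one, mul_one, ← mul_div_assoc, div_lt_one h2w]
      linarith
  rw [h1, mul_comm, ← h2]
  exact sq_lintegral_mul_le _ hf hwm

end Euclidean

/-- Rotation invariance of the standard Gaussian law on the plane. -/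
lemma gaussianReal_prod_map_rotation (κ : ℝ) :
    ((gaussianReal 0 1).prod (gaussianReal 0 1)).map
      (fun p => ((p.1 - κ * p.2) / √(1 + κ ^ 2), (κ * p.1 + p.2) / √(1 + κ ^ 2)))
      = (gaussianReal 0 1).prod (gaussianReal 0 1) := by
  have h := IsGaussian.map_rotation_eq_self (μ := gaussianReal 0 1) (by simp)
    (-Real.arctan κ)
  convert h using 2
  ext p
  · simp [ContinuousLinearMap.rotation_apply, Real.cos_arctan, Real.sin_arctan]
    ring
  · simp [ContinuousLinearMap.rotation_apply, Real.cos_arctan, Real.sin_arctan]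
    ring

/-! ### Mechanisms with Gaussian covariates and Gaussian noise -/

/-- Along `g`, the variable `F` depends only on the second factor, so it is independent of the first
and its conditional expectation is its mean. -/
lemma condExp_comp_snd_of_prod {α : Type*} [MeasurableSpace α] (ν : Measure α)
    [IsProbabilityMeasure ν] {γ : Measure ℝ} [IsProbabilityMeasure γ] {g : α × ℝ → α × ℝ}
    (hg : Measurable g) (hfst : ∀ z, (g z).1 = z.1) {F : α × ℝ → ℝ} (hF : Measurable F)
    {k : ℝ → ℝ} (hk : Measurable k) (hFk : ∀ z, F (g z) = k z.2) :
    ((ν.prod γ).map g)[F | MeasurableSpace.comap Prod.fst inferInstance]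
      =ᵐ[(ν.prod γ).map g] fun _ => ∫ y, k y ∂γ := by
  have := Measure.isProbabilityMeasure_map (μ := ν.prod γ) hg.aemeasurable
  have hind : IndepFun F Prod.fst ((ν.prod γ).map g) := by
    have h1 : IndepFun (F ∘ g) (Prod.fst ∘ g) (ν.prod γ) := by
      have e1 : F ∘ g = fun z => k z.2 := funext hFk
      have e2 : Prod.fst ∘ g = fun z => z.1 := funext hfst
      rw [e1, e2]
      exact (indepFun_prod (X := fun x : α => x) (Y := k) measurable_id hk).symm
    rw [indepFun_iff_map_prod_eq_prod_map_map (by fun_prop) (by fun_prop)] at h1 ⊢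
    rw [Measure.map_map (by fun_prop) hg, Measure.map_map hF hg,
      Measure.map_map measurable_fst hg]
    exact h1
  have h := condExp_indep_eq (μ := (ν.prod γ).map g) (f := F) hF.comap_le
    measurable_fst.comap_le (comap_measurable F).stronglyMeasurable hind
  refine h.trans (Filter.Eventually.of_forall fun _ => ?_)
  show ∫ z, F z ∂((ν.prod γ).map g) = _
  rw [integral_map hg.aemeasurable hF.aestronglyMeasurable]
  simp_rw [hFk]
  rw [integral_fun_snd]
  simp

section Mechanism

variable {p : ℕ}

/-- The response map `(x, e) ↦ (x, xᵀ β + σ e)`. -/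
def response (β : EuclideanSpace ℝ (Fin p)) (σ : ℝ≥0) (z : EuclideanSpace ℝ (Fin p) × ℝ) :
    EuclideanSpace ℝ (Fin p) × ℝ :=
  (z.1, ∑ j, z.1 j * β j + σ * z.2)

lemma measurable_response (β : EuclideanSpace ℝ (Fin p)) (σ : ℝ≥0) :
    Measurable (response β σ) := by
  unfold response
  fun_prop

lemma measurable_noise (β : EuclideanSpace ℝ (Fin p)) : Measurable (noise β) := by
  unfold noise
  fun_prop

lemma noise_response (β : EuclideanSpace ℝ (Fin p)) (σ : ℝ≥0)
    (z : EuclideanSpace ℝ (Fin p) × ℝ) : noise β (response β σ z) = σ * z.2 := by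
  simp [noise, response]

lemma map_noise_response (ν : Measure (EuclideanSpace ℝ (Fin p))) [IsProbabilityMeasure ν]
    (β : EuclideanSpace ℝ (Fin p)) (σ : ℝ≥0) :
    ((ν.prod (gaussianReal 0 1)).map (response β σ)).map (noise β)
      = gaussianReal 0 (σ ^ 2) := by
  rw [Measure.map_map (measurable_noise β) (measurable_response β σ),
    show noise β ∘ response β σ = (fun x => (σ : ℝ) * x) ∘ Prod.snd from
      funext (noise_response β σ),
    ← Measure.map_map (by fun_prop) measurable_snd]
  simp only [Measure.map_snd_prod, measure_univ, one_smul, gaussianReal_map_const_mul, mul_zero,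
    mul_one]
  congr 1

/-- The mechanism with covariate law `ν`, coefficient `β` and independent `N(0, σ²)` noise. -/
noncomputable def Mechanism.gaussian (ν : Measure (EuclideanSpace ℝ (Fin p))) [IsGaussian ν]
    (β : EuclideanSpace ℝ (Fin p)) (σ : ℝ≥0) : Mechanism p where
  law := (ν.prod (gaussianReal 0 1)).map (response β σ)
  isProb := Measure.isProbabilityMeasure_map (measurable_response β σ).aemeasurable
  β := β
  σ := σ
  memLp_X := by
    rw [memLp_map_measure_iff measurable_fst.aestronglyMeasurable
      (measurable_response β σ).aemeasurable]
    exact (IsGaussian.memLp_two_id (μ := ν)).comp_fst _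
  memLp_noise := by
    have h := memLp_id_gaussianReal' (μ := 0) (v := σ ^ 2) 2 (by simp)
    rw [← map_noise_response ν β σ, memLp_map_measure_iff aestronglyMeasurable_id
      (measurable_noise β).aemeasurable] at h
    exact h
  condMean := by
    have h := condExp_comp_snd_of_prod ν (γ := gaussianReal 0 1) (measurable_response β σ)
      (fun _ => rfl) (measurable_noise β) (k := fun e => σ * e) (by fun_prop)
      (noise_response β σ)
    have e : ∫ y, (σ : ℝ) * y ∂gaussianReal 0 1 = 0 := by
      rw [integral_const_mul, integral_id_gaussianReal, mul_zero]
    rwa [e] at h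
  condVariance := by
    have hp : IsProbabilityMeasure ((ν.prod (gaussianReal 0 1)).map (response β σ)) :=
      Measure.isProbabilityMeasure_map (measurable_response β σ).aemeasurable
    have h0 := condExp_comp_snd_of_prod ν (γ := gaussianReal 0 1) (measurable_response β σ)
      (fun _ => rfl) (measurable_noise β) (k := fun e => σ * e) (by fun_prop)
      (noise_response β σ)
    have e0 : ∫ y, (σ : ℝ) * y ∂gaussianReal 0 1 = 0 := by
      rw [integral_const_mul, integral_id_gaussianReal, mul_zero]
    rw [e0] at h0
    have h1 := condExp_comp_snd_of_prod ν (γ := gaussianReal 0 1) (measurable_response β σ)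
      (fun _ => rfl) ((measurable_noise β).pow_const 2) (k := fun e => (σ * e) ^ 2) (by fun_prop)
      (fun z => by rw [noise_response])
    have e1 : ∫ y, ((σ : ℝ) * y) ^ 2 ∂gaussianReal 0 1 = σ ^ 2 := by
      have hv := variance_fun_id_gaussianReal (μ := 0) (v := 1)
      rw [variance_eq_integral (by fun_prop), integral_id_gaussianReal] at hv
      simp_rw [mul_pow]
      rw [integral_const_mul]
      simp only [sub_zero, NNReal.coe_one] at hv
      rw [hv, mul_one]
    rw [e1] at h1
    refine Filter.EventuallyEq.trans (condExp_congr_ae ?_) h1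
    filter_upwards [h0] with z hz
    simp [hz]

end Mechanism

/-! ### Membership in the high-dimensional class -/

section InHD

variable {p : ℕ}

/-- The exponential moment equals `(1 - 2 v / c²) ^ (-1/2)`, which reaches `2` exactly at `v = 3 c²
/ 8`. -/
lemma psi2Norm_le_of_map_eq_gaussianReal {Ω : Type*} [MeasurableSpace Ω] {μ : Measure Ω}
    {Z : Ω → ℝ} (hZ : Measurable Z) {v : ℝ≥0} (hμ : μ.map Z = gaussianReal 0 v) {c : ℝ}
    (hc : 0 < c) (hv : v ≤ 3 / 8 * c ^ 2) : psi2Norm Z μ ≤ ENNReal.ofReal c := by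
  unfold psi2Norm
  refine iInf₂_le_of_le c.toNNReal (Real.toNNReal_pos.2 hc) (iInf_le_of_le ?_ le_rfl)
  rw [Real.coe_toNNReal c hc.le]
  have e : ∀ ω, ENNReal.ofReal (Real.exp (Z ω ^ 2 / c ^ 2))
      = (fun x : ℝ => ENNReal.ofReal (Real.exp ((c ^ 2)⁻¹ * x ^ 2))) (Z ω) := by
    intro ω
    simp only
    congr 3
    ring
  have hq : 2 * (c ^ 2)⁻¹ * (v : ℝ) ≤ 3 / 4 := by
    rw [show 2 * (c ^ 2)⁻¹ * (v : ℝ) = 2 * v / c ^ 2 by ring, div_le_iff₀ (by positivity)]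
    linarith
  rw [lintegral_congr e, ← lintegral_map (f := fun x : ℝ =>
    ENNReal.ofReal (Real.exp ((c ^ 2)⁻¹ * x ^ 2))) (by fun_prop) hZ, hμ,
    lintegral_exp_mul_sq_gaussianReal _ (by linarith), ← ENNReal.ofReal_ofNat]
  apply ENNReal.ofReal_le_ofReal
  have h1 : (1 / 2 : ℝ) ≤ √(1 - 2 * (c ^ 2)⁻¹ * v) := Real.le_sqrt_of_sq_le (by linarith)
  calc (√(1 - 2 * (c ^ 2)⁻¹ * v))⁻¹ ≤ (1 / 2)⁻¹ := inv_anti₀ (by norm_num) h1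
    _ = _ := by norm_num

/-- The denominator of the restricted eigenvalue is at most `‖δ‖²`, so a lower bound on the whole
spectrum suffices. -/
lemma le_restrictedEigenvalue {A : Matrix (Fin p) (Fin p) ℝ} {Φ : ℝ} (hΦ : 0 ≤ Φ)
    (h : ∀ δ : Fin p → ℝ, Φ * ∑ i, δ i ^ 2 ≤ δ ⬝ᵥ A.mulVec δ) (s : ℕ) :
    (Φ : EReal) ≤ restrictedEigenvalue A s := by
  unfold restrictedEigenvalue
  refine le_iInf₂ fun S _ => le_iInf₂ fun δ hδ => le_iInf fun hcone => ?_
  rw [EReal.coe_le_coe_iff]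
  have hsub : S ⊆ topSupport δ S s := Finset.subset_union_left
  -- Division by zero would give the value `0`, so positivity must be proved: if `δ` vanishes on
  -- `S`, the cone condition makes it vanish everywhere.
  have hpos : 0 < ∑ i ∈ topSupport δ S s, δ i ^ 2 := by
    by_contra! hle
    have h0 : ∀ i ∈ topSupport δ S s, δ i ^ 2 = 0 :=
      (Finset.sum_eq_zero_iff_of_nonneg fun i _ => sq_nonneg (δ i)).1
        (le_antisymm hle (Finset.sum_nonneg fun i _ => sq_nonneg _))
    have hS : ∀ i ∈ S, δ i = 0 := fun i hi => by simpa using h0 i (hsub hi)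
    have hS0 : ∑ i ∈ S, |δ i| = 0 := Finset.sum_eq_zero fun i hi => by simp [hS i hi]
    rw [hS0] at hcone
    have hSc := (Finset.sum_eq_zero_iff_of_nonneg fun i _ => abs_nonneg (δ i)).1
        (le_antisymm hcone (Finset.sum_nonneg fun i _ => abs_nonneg _))
    apply hδ
    ext i
    by_cases hi : i ∈ S
    · exact hS i hi
    · simpa using hSc i (Finset.mem_compl.2 hi)
  rw [le_div_iff₀ hpos]
  refine le_trans ?_ (h δ)
  gcongr
  exact Finset.subset_univ _

/-- A Gaussian mechanism belongs to the class if the variance of its covariates is suitably bounded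
in all directions. -/
theorem inHD_gaussian {ν : Measure (EuclideanSpace ℝ (Fin p))} [IsGaussian ν]
    {β : EuclideanSpace ℝ (Fin p)} {σ : ℝ≥0} {RX R B Φ : ℝ} {s : ℕ} (hRX : 0 < RX) (hΦ : 0 ≤ Φ)
    (hν : ∀ x : EuclideanSpace ℝ (Fin p), ∃ v : ℝ≥0,
      ν.map (fun y => inner ℝ x y) = gaussianReal 0 v ∧ Φ * ‖x‖ ^ 2 ≤ v ∧
        v ≤ 3 / 8 * RX ^ 2 * ‖x‖ ^ 2)
    (hs : (Finset.univ.filter fun j => β j ≠ 0).card ≤ s) (hB : ‖β‖ ≤ B) (hσ : σ ≤ R) :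
    InHD RX R B s Φ (Mechanism.gaussian ν β σ) := by
  have hfst : (Mechanism.gaussian ν β σ).law.map Prod.fst = ν := by
    show ((ν.prod (gaussianReal 0 1)).map (response β σ)).map Prod.fst = ν
    rw [Measure.map_map measurable_fst (measurable_response β σ),
      show Prod.fst ∘ response β σ = Prod.fst from rfl, Measure.map_fst_prod]
    simp
  have hcomp : ∀ x : EuclideanSpace ℝ (Fin p),
      (Mechanism.gaussian ν β σ).law.map (fun z => inner ℝ x z.1)
        = ν.map (fun y => inner ℝ x y) := by
    intro x
    conv_rhs => rw [← hfst]
    rw [Measure.map_map (by fun_prop) measurable_fst]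
    rfl
  refine ⟨?_, ?_, ⟨?_, ?_⟩, ?_, hs, hB, hσ⟩
  · refine iSup₂_le fun x hx => ?_
    obtain ⟨v, hv, -, hv2⟩ := hν x
    refine psi2Norm_le_of_map_eq_gaussianReal (by fun_prop) ((hcomp x).trans hv) hRX ?_
    rw [hx] at hv2
    linarith
  · intro j
    obtain ⟨v, hv, -⟩ := hν (EuclideanSpace.single j 1)
    have e : ∀ z : EuclideanSpace ℝ (Fin p) × ℝ,
        z.1 j = inner ℝ (EuclideanSpace.single j (1 : ℝ)) z.1 := by
      intro z; simp [EuclideanSpace.inner_single_left]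
    simp_rw [e]
    rw [← integral_map (f := fun y : ℝ => y) (φ := fun z : EuclideanSpace ℝ (Fin p) × ℝ =>
      inner ℝ (EuclideanSpace.single j (1 : ℝ)) z.1) (Measurable.aemeasurable (by fun_prop))
      (by fun_prop), hcomp, hv, integral_id_gaussianReal]
  · intro t
    have h := integrable_exp_mul_gaussianReal (μ := 0) (v := σ ^ 2) t
    rw [← map_noise_response ν β σ, integrable_map_measure (by fun_prop)
      (measurable_noise β).aemeasurable] at h
    exact h
  · intro t
    show mgf (noise β) ((ν.prod (gaussianReal 0 1)).map (response β σ)) t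
      ≤ Real.exp ((σ ^ 2 : ℝ≥0) * t ^ 2 / 2)
    rw [mgf_gaussianReal (map_noise_response ν β σ)]
    simp
  · refine le_restrictedEigenvalue hΦ (fun δ => ?_) s
    obtain ⟨v, hv, hv1, -⟩ := hν (WithLp.toLp 2 δ)
    have hL2 : ∀ i, MemLp (fun z : EuclideanSpace ℝ (Fin p) × ℝ => z.1 i) 2
        (Mechanism.gaussian ν β σ).law := fun i =>
      (Mechanism.gaussian ν β σ).memLp_X.eval_piLp i
    have e1 : δ ⬝ᵥ (Mechanism.gaussian ν β σ).secondMoment.mulVec δ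
        = ∫ z, (inner ℝ (WithLp.toLp 2 δ) z.1) ^ 2 ∂(Mechanism.gaussian ν β σ).law := by
      have e2 : ∀ z : EuclideanSpace ℝ (Fin p) × ℝ, (inner ℝ (WithLp.toLp 2 δ) z.1 : ℝ) ^ 2
          = ∑ i, ∑ j, δ i * (z.1 i * z.1 j * δ j) := by
        intro z
        rw [sq, PiLp.inner_apply, Finset.sum_mul_sum]
        refine Finset.sum_congr rfl fun i _ => Finset.sum_congr rfl fun j _ => ?_
        simp
        ring
      simp_rw [e2]
      have hint : ∀ i j, Integrable (fun z : EuclideanSpace ℝ (Fin p) × ℝ => z.1 i * z.1 j)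
          (Mechanism.gaussian ν β σ).law := fun i j => (hL2 i).integrable_mul (hL2 j)
      rw [integral_finsetSum _ fun i _ => integrable_finsetSum _ fun j _ =>
        ((hint i j).mul_const _).const_mul _]
      simp only [dotProduct, Matrix.mulVec, Mechanism.secondMoment, Matrix.of_apply,
        Finset.mul_sum]
      refine Finset.sum_congr rfl fun i _ => ?_
      rw [integral_finsetSum _ fun j _ => ((hint i j).mul_const _).const_mul _]
      refine Finset.sum_congr rfl fun j _ => ?_
      rw [integral_const_mul, integral_mul_const]
    have e3 : ∫ z, (inner ℝ (WithLp.toLp 2 δ) z.1) ^ 2 ∂(Mechanism.gaussian ν β σ).law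
        = v := by
      rw [← integral_map (f := fun y : ℝ => y ^ 2) (φ := fun z : EuclideanSpace ℝ (Fin p) × ℝ =>
        inner ℝ (WithLp.toLp 2 δ) z.1) (Measurable.aemeasurable (by fun_prop))
        (by fun_prop), hcomp, hv]
      have hvar := variance_fun_id_gaussianReal (μ := 0) (v := v)
      rw [variance_eq_integral (by fun_prop), integral_id_gaussianReal] at hvar
      simpa using hvar
    rw [e1, e3]
    rw [EuclideanSpace.real_norm_sq_eq] at hv1
    simpa using hv1

end InHD

/-! ### Sparse directions -/

section SparseDir

variable {p q m : ℕ}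

/-- The unit vector with equal nonzero entries at the positions `ι (i, f i)`. -/
noncomputable def sparseDir (ι : Fin q × Fin m ↪ Fin p) (f : Fin q → Fin m) :
    EuclideanSpace ℝ (Fin p) :=
  (√q)⁻¹ • ∑ i, EuclideanSpace.single (ι (i, f i)) 1

lemma inner_sparseDir_left (ι : Fin q × Fin m ↪ Fin p) (f : Fin q → Fin m)
    (z : EuclideanSpace ℝ (Fin p)) :
    inner ℝ (sparseDir ι f) z = (√q)⁻¹ * ∑ i, z (ι (i, f i)) := by
  simp [sparseDir, real_inner_smul_left, sum_inner, EuclideanSpace.inner_single_left]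

lemma sparseDir_apply (ι : Fin q × Fin m ↪ Fin p) (f : Fin q → Fin m) (j : Fin p) :
    sparseDir ι f j = (√q)⁻¹ * ∑ i, if j = ι (i, f i) then 1 else 0 := by
  simp [sparseDir, Pi.single_apply]

/-- Positions from different groups never coincide, so the inner product counts the groups on which
`f` and `f'` agree. -/
lemma inner_sparseDir (hq : 0 < q) (ι : Fin q × Fin m ↪ Fin p) (f f' : Fin q → Fin m) :
    inner ℝ (sparseDir ι f) (sparseDir ι f') = 1 - (hammingDist f f' : ℝ) / q := by
  have hq' : (0 : ℝ) < q := by exact_mod_cast hq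
  have h1 : ∀ i, ∑ k, (if ι (i, f i) = ι (k, f' k) then (1 : ℝ) else 0)
      = 1 - if f i ≠ f' i then 1 else 0 := by
    intro i
    rw [Finset.sum_eq_single i]
    · by_cases h : f i = f' i <;> simp [h]
    · intro k _ hk
      simp [Ne.symm hk]
    · simp
  rw [inner_sparseDir_left]
  simp_rw [sparseDir_apply, h1]
  rw [← Finset.mul_sum, Finset.sum_sub_distrib, ← mul_assoc, ← mul_inv,
    Real.mul_self_sqrt hq'.le]
  simp only [Finset.sum_const, Finset.card_univ, Fintype.card_fin, nsmul_eq_mul, mul_one,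
    Finset.sum_boole, hammingDist]
  field_simp

lemma norm_sparseDir (hq : 0 < q) (ι : Fin q × Fin m ↪ Fin p) (f : Fin q → Fin m) :
    ‖sparseDir ι f‖ = 1 := by
  have := inner_sparseDir hq ι f f
  rw [real_inner_self_eq_norm_sq, hammingDist_self, Nat.cast_zero, zero_div, sub_zero] at this
  exact (pow_eq_one_iff_of_nonneg (norm_nonneg _) two_ne_zero).1 this

lemma norm_sparseDir_sub_sq (hq : 0 < q) (ι : Fin q × Fin m ↪ Fin p) (f f' : Fin q → Fin m) :
    ‖sparseDir ι f - sparseDir ι f'‖ ^ 2 = 2 * hammingDist f f' / q := by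
  rw [norm_sub_sq_real, inner_sparseDir hq, norm_sparseDir hq, norm_sparseDir hq]
  ring

lemma sparseDir_apply_eq_zero (ι : Fin q × Fin m ↪ Fin p) (f : Fin q → Fin m) {j : Fin p}
    (hj : j ∉ Set.range ι) : sparseDir ι f j = 0 := by
  rw [sparseDir_apply, Finset.sum_eq_zero, mul_zero]
  intro i _
  rw [if_neg]
  rintro rfl
  exact hj ⟨_, rfl⟩

lemma sparseDir_support_subset (ι : Fin q × Fin m ↪ Fin p) (f : Fin q → Fin m) {j : Fin p}
    (hj : sparseDir ι f j ≠ 0) : j ∈ Finset.univ.image fun i => ι (i, f i) := by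
  by_contra h
  apply hj
  rw [sparseDir_apply, Finset.sum_eq_zero, mul_zero]
  intro i _
  rw [if_neg]
  rintro rfl
  exact h (Finset.mem_image_of_mem _ (Finset.mem_univ i))

lemma card_image_sparse_le (ι : Fin q × Fin m ↪ Fin p) (f : Fin q → Fin m) :
    (Finset.univ.image fun i => ι (i, f i)).card ≤ q :=
  Finset.card_image_le.trans (by simp)

/-- Permuting coordinates in the range of `ι` moves one sparse direction to another. -/
lemma exists_isometry_sparseDir (ι : Fin q × Fin m ↪ Fin p) (f f₀ : Fin q → Fin m) :
    ∃ U : EuclideanSpace ℝ (Fin p) ≃ₗᵢ[ℝ] EuclideanSpace ℝ (Fin p),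
      (∀ z, ∀ j ∉ Set.range ι, U z j = z j) ∧
      ∀ z, inner ℝ (sparseDir ι f) (U z) = inner ℝ (sparseDir ι f₀) z := by
  -- In each group `i`, swap the positions `f i` and `f₀ i`; outside the range of `ι` nothing moves.
  let e : Equiv.Perm (Fin q × Fin m) :=
    Equiv.prodShear (Equiv.refl _) fun i => Equiv.swap (f i) (f₀ i)
  let π : Equiv.Perm (Fin p) := e.viaEmbedding ι
  refine ⟨LinearIsometryEquiv.piLpCongrLeft 2 ℝ ℝ π.symm, ?_, ?_⟩
  · intro z j hj
    have : π j = j := Equiv.Perm.viaEmbedding_apply_of_notMem e ι j hj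
    show z (π.symm.symm j) = z j
    rw [Equiv.symm_symm, this]
  · intro z
    rw [inner_sparseDir_left, inner_sparseDir_left]
    congr 1
    refine Finset.sum_congr rfl fun i _ => ?_
    have : π (ι (i, f i)) = ι (i, f₀ i) := by
      rw [Equiv.Perm.viaEmbedding_apply]
      simp [e]
    show z (π.symm.symm (ι (i, f i))) = _
    rw [Equiv.symm_symm, this]

lemma exists_embedding_into {A : Finset (Fin p)} (h : q * m ≤ A.card) :
    ∃ ι : Fin q × Fin m ↪ Fin p, Set.range ι ⊆ A := by
  obtain ⟨e⟩ := Function.Embedding.nonempty_of_card_le (α := Fin q × Fin m) (β := A)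
    (by simpa using h)
  refine ⟨e.trans (Function.Embedding.subtype _), ?_⟩
  rintro _ ⟨x, rfl⟩
  exact (e x).2

end SparseDir

/-- Isometry invariance of the standard Gaussian law. It serves to show that patterns missing the
range of `ι` have the same law for all `f`. -/
lemma stdGaussian_prod_map_eq_of_isometry {E α' β' : Type*} [NormedAddCommGroup E]
    [InnerProductSpace ℝ E] [FiniteDimensional ℝ E] [MeasurableSpace E] [BorelSpace E]
    [MeasurableSpace α'] [MeasurableSpace β'] (μ : Measure β') [SFinite μ] (U : E ≃ₗᵢ[ℝ] E)
    {g g' : E × β' → α'} (hg : Measurable g) (h : ∀ z b, g (U z, b) = g' (z, b)) :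
    ((stdGaussian E).prod μ).map g = ((stdGaussian E).prod μ).map g' := by
  have hU : ((stdGaussian E).prod μ).map (Prod.map U id) = (stdGaussian E).prod μ := by
    rw [← Measure.map_prod_map _ _ U.continuous.measurable measurable_id, stdGaussian_map,
      Measure.map_id]
  conv_lhs => rw [← hU]
  rw [Measure.map_map hg (U.continuous.measurable.prodMap measurable_id)]
  congr 1
  ext ⟨z, b⟩
  exact h z b

/-! ### Domination of the law of the data -/

section DataLaw

lemma Design.block_subset_or_disjoint (D : Design) (l : Fin D.L) (k : Fin D.K) :
    D.block l ⊆ D.O k ∨ Disjoint (D.block l) (D.O k) := by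
  obtain ⟨T, hT⟩ := D.compatible.union k
  rw [hT]
  by_cases hl : l ∈ T
  · exact Or.inl (Finset.subset_biUnion_of_mem _ hl)
  · right
    rw [Finset.disjoint_biUnion_right]
    intro i hi
    exact D.compatible.disjoint l i fun h => hl (h ▸ hi)

lemma Design.h_pos (D : Design) (l : Fin D.L) : 0 < D.h l := by
  obtain ⟨j, hj⟩ := D.compatible.nonempty l
  obtain ⟨k, hk, hn⟩ := D.observed j
  have hsub : D.block l ⊆ D.O k := by
    refine (D.block_subset_or_disjoint l k).resolve_right fun h => ?_
    exact Finset.disjoint_left.1 h hj hk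
  unfold Design.h
  refine Finset.sum_pos' (fun _ _ => Nat.zero_le _) ⟨k, Finset.mem_univ k, ?_⟩
  simpa [hsub] using hn

/-- The part of a labelled observation which is recorded in pattern `k`. -/
def Design.obs (D : Design) (k : Fin D.K) (z : EuclideanSpace ℝ (Fin D.p) × ℝ) :
    (D.O k → ℝ) × ℝ := (fun j => z.1 j, z.2)

lemma Design.measurable_obs (D : Design) (k : Fin D.K) : Measurable (D.obs k) := by
  unfold Design.obs
  fun_prop

instance Mechanism.isProbabilityMeasure_law {p : ℕ} (P : Mechanism p) :
    IsProbabilityMeasure P.law := P.isProb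

instance Design.isProbabilityMeasure_map_obs (D : Design) (k : Fin D.K)
    (μ : Measure (EuclideanSpace ℝ (Fin D.p) × ℝ)) [IsProbabilityMeasure μ] :
    IsProbabilityMeasure (μ.map (D.obs k)) :=
  Measure.isProbabilityMeasure_map (D.measurable_obs k).aemeasurable

/-- The law of the data in which the labelled observations in pattern `k` have law `Q k` and the
unlabelled ones have law `Q'`. -/
noncomputable def Design.productLaw (D : Design) (Q : (k : Fin D.K) → Measure ((D.O k → ℝ) × ℝ))
    (Q' : Measure (EuclideanSpace ℝ (Fin D.p))) : Measure D.Data :=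
  (Measure.pi fun k => Measure.pi fun _ : Fin (D.n k) => Q k).prod
    (Measure.pi fun _ : Fin D.N => Q')

instance (D : Design) (Q : (k : Fin D.K) → Measure ((D.O k → ℝ) × ℝ))
    (Q' : Measure (EuclideanSpace ℝ (Fin D.p))) [∀ k, IsProbabilityMeasure (Q k)]
    [IsProbabilityMeasure Q'] : IsProbabilityMeasure (D.productLaw Q Q') := by
  unfold Design.productLaw
  infer_instance

lemma Design.dataLaw_eq_productLaw (D : Design) (P : Mechanism D.p) :
    D.dataLaw P = D.productLaw (fun k => P.law.map (D.obs k)) (P.law.map Prod.fst) := rfl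

instance (D : Design) (P : Mechanism D.p) : IsProbabilityMeasure (D.dataLaw P) := by
  have : IsProbabilityMeasure (P.law.map Prod.fst) :=
    Measure.isProbabilityMeasure_map measurable_fst.aemeasurable
  rw [D.dataLaw_eq_productLaw]
  infer_instance

/-- `I` marks the informative patterns. All others agree with the reference law and cost a factor
`1`, so the exponent counts informative labelled observations only. -/
lemma Design.chiSqDominated_dataLaw (D : Design) (P : Mechanism D.p)
    {Q : (k : Fin D.K) → Measure ((D.O k → ℝ) × ℝ)} {Q' : Measure (EuclideanSpace ℝ (Fin D.p))}
    [∀ k, IsProbabilityMeasure (Q k)] [IsProbabilityMeasure Q']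
    (I : Fin D.K → Prop) [DecidablePred I] {c c' : ℝ≥0∞}
    (h1 : ∀ k, I k → ChiSqDominated (P.law.map (D.obs k)) (Q k) c)
    (h0 : ∀ k, ¬ I k → P.law.map (D.obs k) = Q k)
    (h' : ChiSqDominated (P.law.map Prod.fst) Q' c') :
    ChiSqDominated (D.dataLaw P) (D.productLaw Q Q')
      (c ^ (∑ k, if I k then D.n k else 0) * c' ^ D.N) := by
  have : IsProbabilityMeasure (P.law.map Prod.fst) :=
    Measure.isProbabilityMeasure_map measurable_fst.aemeasurable
  rw [D.dataLaw_eq_productLaw]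
  have hk : ∀ k, ChiSqDominated (P.law.map (D.obs k)) (Q k) (if I k then c else 1) := by
    intro k
    by_cases hI : I k
    · simpa [hI] using h1 k hI
    · simpa [hI, h0 k hI] using ChiSqDominated.refl (Q k)
  have hpi := (ChiSqDominated.pi fun k => ChiSqDominated.pi fun _ : Fin (D.n k) => hk k).prod
    (ChiSqDominated.pi fun _ : Fin D.N => h')
  refine ChiSqDominated.mono hpi (le_of_eq ?_)
  rw [← Finset.prod_pow_eq_pow_sum]
  simp only [Finset.prod_const, Finset.card_univ, Fintype.card_fin]
  congr 1
  refine Finset.prod_congr rfl fun k _ => ?_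
  by_cases hI : I k <;> simp [hI]

end DataLaw

/-- The right side is `m ^ (q / 4)`; this turns the chi-square budget into the additive condition
that the exponents sum to at most `q Λ / 4`. -/
lemma exp_le_sqrt_rpow {q m : ℕ} (hm : 0 < m) {Λ : ℝ} (hΛ : Real.exp Λ ≤ m) :
    Real.exp (q * Λ / 4) ≤ √m ^ ((q : ℝ) / 2) := by
  have hm' : (0 : ℝ) < m := by exact_mod_cast hm
  rw [Real.sqrt_eq_rpow, ← Real.rpow_mul hm'.le, Real.rpow_def_of_pos hm', Real.exp_le_exp]
  have : Λ ≤ Real.log m := (Real.le_log_iff_exp_le hm').2 hΛ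
  have hq : (0 : ℝ) ≤ q := by positivity
  nlinarith

/-! ### The bound from the observations of a single modality -/

section SingleModality

/-- The law of a standard Gaussian vector multiplied by `c`. -/
noncomputable def isotropicLaw (p : ℕ) (c : ℝ) : Measure (EuclideanSpace ℝ (Fin p)) :=
  (stdGaussian (EuclideanSpace ℝ (Fin p))).map fun z => c • z

instance (p : ℕ) (c : ℝ) : IsGaussian (isotropicLaw p c) := by
  unfold isotropicLaw
  exact isGaussian_map (μ := stdGaussian (EuclideanSpace ℝ (Fin p)))
    (c • ContinuousLinearMap.id ℝ (EuclideanSpace ℝ (Fin p)))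

variable {p q m : ℕ}

lemma isotropicLaw_map_inner (c : ℝ) (x : EuclideanSpace ℝ (Fin p)) :
    (isotropicLaw p c).map (fun y => inner ℝ x y) = gaussianReal 0 (‖c • x‖₊ ^ 2) := by
  unfold isotropicLaw
  rw [Measure.map_map (by fun_prop) (by fun_prop), ← stdGaussian_map_inner]
  congr 1
  ext z
  simp [real_inner_smul_left, real_inner_smul_right]

/-- Isotropic covariates with variance `c²` and a sparse regression coefficient of norm `d`. -/
noncomputable def isotropicMechanism (ι : Fin q × Fin m ↪ Fin p) (c d : ℝ) (σ : ℝ≥0)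
    (f : Fin q → Fin m) : Mechanism p :=
  Mechanism.gaussian (isotropicLaw p c) (d • sparseDir ι f) σ

lemma isotropicMechanism_law (ι : Fin q × Fin m ↪ Fin p) (c d : ℝ) (σ : ℝ≥0)
    (f : Fin q → Fin m) : (isotropicMechanism ι c d σ f).law
      = ((stdGaussian (EuclideanSpace ℝ (Fin p))).prod (gaussianReal 0 1)).map
        fun z => (c • z.1, d * c * inner ℝ (sparseDir ι f) z.1 + σ * z.2) := by
  show ((isotropicLaw p c).prod (gaussianReal 0 1)).map (response (d • sparseDir ι f) σ) = _
  have h : (isotropicLaw p c).prod (gaussianReal 0 1)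
      = ((stdGaussian (EuclideanSpace ℝ (Fin p))).prod (gaussianReal 0 1)).map
        (Prod.map (fun z => c • z) id) := by
    rw [← Measure.map_prod_map _ _ (by fun_prop) measurable_id, Measure.map_id]
    rfl
  rw [h, Measure.map_map (measurable_response _ _) (by fun_prop)]
  congr 1
  ext z
  · rfl
  · simp only [response, Function.comp, Prod.map, PiLp.smul_apply, smul_eq_mul, PiLp.inner_apply,
      RCLike.inner_apply, conj_trivial, Finset.mul_sum, id]
    congr 1
    exact Finset.sum_congr rfl fun _ _ => by ring

lemma isotropicMechanism_law_map_fst (ι : Fin q × Fin m ↪ Fin p) (c d : ℝ) (σ : ℝ≥0)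
    (f : Fin q → Fin m) :
    (isotropicMechanism ι c d σ f).law.map Prod.fst = isotropicLaw p c := by
  show (((isotropicLaw p c).prod (gaussianReal 0 1)).map (response _ σ)).map Prod.fst = _
  rw [Measure.map_map measurable_fst (measurable_response _ σ),
    show Prod.fst ∘ response (d • sparseDir ι f) σ = Prod.fst from rfl, Measure.map_fst_prod]
  simp

lemma isotropicMechanism_inHD (hq : 0 < q) (ι : Fin q × Fin m ↪ Fin p) {d RX R B Φ : ℝ} {s : ℕ}
    (hRX : 0 < RX) (hR : 0 ≤ R) (hΦ : 0 ≤ Φ) (hΦ' : Φ ≤ 3 / 8 * RX ^ 2) (hd : 0 ≤ d)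
    (hdB : d ≤ B) (hqs : q ≤ s) (f : Fin q → Fin m) :
    InHD RX R B s Φ (isotropicMechanism ι √Φ d R.toNNReal f) := by
  refine inHD_gaussian hRX hΦ (fun x => ⟨_, isotropicLaw_map_inner _ x, ?_, ?_⟩) ?_ ?_ ?_
  · simp [norm_smul, mul_pow, Real.sq_sqrt hΦ]
  · have : ((‖√Φ • x‖₊ ^ 2 : ℝ≥0) : ℝ) = Φ * ‖x‖ ^ 2 := by
      simp [norm_smul, mul_pow, Real.sq_sqrt hΦ]
    rw [this]
    gcongr
  · refine (Finset.card_le_card fun j hj => ?_).trans ((card_image_sparse_le ι f).trans hqs)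
    refine sparseDir_support_subset ι f fun h => (Finset.mem_filter.1 hj).2 ?_
    simp [h]
  · rw [norm_smul, norm_sparseDir hq, mul_one, Real.norm_of_nonneg hd]
    exact hdB
  · rw [Real.coe_toNNReal _ hR]

/-- The law of a fully observed labelled observation is dominated by a law with independent
covariates and response. -/
lemma isotropicMechanism_chiSqDominated (hq : 0 < q) (ι : Fin q × Fin m ↪ Fin p) (c d : ℝ)
    {σ : ℝ≥0} (hσ : 0 < σ) (f : Fin q → Fin m) :
    ChiSqDominated (isotropicMechanism ι c d σ f).law
      (((stdGaussian (EuclideanSpace ℝ (Fin p))).prod (gaussianReal 0 1)).map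
        fun z => (c • z.1, √((d * c) ^ 2 + σ ^ 2) * z.2))
      (ENNReal.ofReal (1 + (d * c) ^ 2 / σ ^ 2)) := by
  have hσ' : (0 : ℝ) < σ := hσ
  set S := √((d * c) ^ 2 + (σ : ℝ) ^ 2) with hS
  have hS2 : S ^ 2 = (d * c) ^ 2 + (σ : ℝ) ^ 2 := Real.sq_sqrt (by positivity)
  have hSpos : 0 < S := Real.sqrt_pos.2 (by positivity)
  -- Divided by its standard deviation `S`, the response is a standard Gaussian coordinate with
  -- correlation `d c / S` to the direction; the constant is `S² / σ²`.
  have h := (chiSqDominated_spike (norm_sparseDir hq ι f) (r := d * c / S) (w := σ / S)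
    (by positivity) (by rw [div_pow, div_pow, ← add_div, ← hS2, div_self (by positivity)])).map
    (g := fun z : EuclideanSpace ℝ (Fin p) × ℝ => (c • z.1, S * z.2)) (by fun_prop)
  rw [Measure.map_map (by fun_prop) (by fun_prop)] at h
  rw [isotropicMechanism_law]
  convert h using 2
  · ext z
    · rfl
    · simp only [Function.comp]
      field_simp
  · rw [div_pow, hS2, inv_div]
    field_simp
    ring

theorem singleModality_bound (D : Design) {RX R B Φ : ℝ} {s : ℕ} (hRX : 0 < RX) (hR : 0 < R)
    (hΦ : 0 < Φ) (hΦ' : Φ ≤ 3 / 8 * RX ^ 2) (hs : 0 < s) (hm : 4096 ≤ m)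
    (l : Fin D.L) (hcard : s * m ≤ (D.block l).card) {d Λ : ℝ} (hd : 0 < d) (hdB : d ≤ B)
    (hΛ : Real.exp Λ ≤ m) (hχ : D.h l * (Φ * d ^ 2 / R ^ 2) ≤ s * Λ / 4) :
    ENNReal.ofReal (d ^ 2 / 8) ≤ D.minimaxRisk RX R B s Φ := by
  obtain ⟨ι, hι⟩ := exists_embedding_into hcard
  have hR' : 0 < R.toNNReal := Real.toNNReal_pos.2 hR
  have hRc : ((R.toNNReal : ℝ≥0) : ℝ) = R := Real.coe_toNNReal R hR.le
  set P := isotropicMechanism ι √Φ d R.toNNReal with hPdef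
  let f₀ : Fin s → Fin m := fun _ => ⟨0, by omega⟩
  let Q₀ := ((stdGaussian (EuclideanSpace ℝ (Fin D.p))).prod (gaussianReal 0 1)).map
        fun z => (√Φ • z.1, √((d * √Φ) ^ 2 + (R.toNNReal : ℝ) ^ 2) * z.2)
  have hQ₀ : IsProbabilityMeasure Q₀ :=
    Measure.isProbabilityMeasure_map (Measurable.aemeasurable (by fun_prop))
  -- Uninformative patterns take the actual law of an arbitrary reference index `f₀` as their
  -- dominating law.
  let Q : (k : Fin D.K) → Measure ((D.O k → ℝ) × ℝ) := fun k =>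
    if D.block l ⊆ D.O k then Q₀.map (D.obs k) else (P f₀).law.map (D.obs k)
  have hQ : ∀ k, IsProbabilityMeasure (Q k) := by
    intro k
    by_cases hk : D.block l ⊆ D.O k <;> simp only [Q, hk, if_true, if_false] <;> infer_instance
  have hx : 0 ≤ Φ * d ^ 2 / R ^ 2 := by positivity
  refine le_minimaxRisk_of_chiSqDominated D hs hm P
    (fun f => isotropicMechanism_inHD hs ι hRX hR.le hΦ.le hΦ' hd.le hdB le_rfl f)
    (D.productLaw Q (isotropicLaw D.p √Φ)) (χ := (1 + Φ * d ^ 2 / R ^ 2) ^ D.h l) ?_ ?_ hd ?_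
  · refine le_trans ?_ (exp_le_sqrt_rpow (by omega) hΛ)
    calc (1 + Φ * d ^ 2 / R ^ 2) ^ D.h l ≤ Real.exp (Φ * d ^ 2 / R ^ 2) ^ D.h l := by
          gcongr
          rw [add_comm]
          exact Real.add_one_le_exp _
      _ = Real.exp (D.h l * (Φ * d ^ 2 / R ^ 2)) := by rw [← Real.exp_nat_mul]
      _ ≤ _ := Real.exp_le_exp.2 hχ
  · intro f
    have h := D.chiSqDominated_dataLaw (P f) (Q := Q) (Q' := isotropicLaw D.p √Φ)
      (fun k => D.block l ⊆ D.O k) (c := ENNReal.ofReal (1 + Φ * d ^ 2 / R ^ 2)) (c' := 1)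
      ?_ ?_ ?_
    · refine h.mono (le_of_eq ?_)
      rw [one_pow, mul_one, ENNReal.ofReal_pow (by positivity)]
      rfl
    · intro k hk
      have := (isotropicMechanism_chiSqDominated hs ι √Φ d hR' f).map (D.measurable_obs k)
      rw [hRc, mul_pow, Real.sq_sqrt hΦ.le, mul_comm (d ^ 2)] at this
      simp only [Q, hk, if_true, Q₀, hRc, mul_pow, Real.sq_sqrt hΦ.le, mul_comm (d ^ 2)]
      exact this
    · intro k hk
      -- A pattern not containing the block misses it entirely, so the permutation carrying `u_f` to
      -- `u_{f₀}` moves only unseen coordinates.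
      have hdisj := (D.block_subset_or_disjoint l k).resolve_left hk
      obtain ⟨U, hU1, hU2⟩ := exists_isometry_sparseDir ι f f₀
      simp only [Q, hk, if_false, hPdef, isotropicMechanism_law]
      rw [Measure.map_map (D.measurable_obs k) (by fun_prop),
        Measure.map_map (D.measurable_obs k) (by fun_prop)]
      refine stdGaussian_prod_map_eq_of_isometry _ U
        ((D.measurable_obs k).comp (by fun_prop)) fun z e => ?_
      simp only [Function.comp, Design.obs, hU2]
      congr 1
      ext j
      have hj : (j : Fin D.p) ∉ Set.range ι := fun hj =>
        Finset.disjoint_left.1 hdisj (hι hj) j.2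
      simp [hU1 z j hj]
    · rw [hPdef, isotropicMechanism_law_map_fst]
      exact ChiSqDominated.refl _
  · intro f f'
    refine le_of_eq ?_
    show _ = ‖d • sparseDir ι f - d • sparseDir ι f'‖ ^ 2
    rw [← smul_sub, norm_smul, mul_pow, norm_sparseDir_sub_sq hs, Real.norm_eq_abs, sq_abs]

end SingleModality

/-! ### The bound from the joint observations of two modalities -/

section CrossModality

variable {p q m : ℕ}

/-- The vector `z` with its entry `j₀` replaced by `x`. -/
noncomputable def setCoord (j₀ : Fin p) (z : EuclideanSpace ℝ (Fin p)) (x : ℝ) :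
    EuclideanSpace ℝ (Fin p) :=
  z + (x - z j₀) • EuclideanSpace.single j₀ 1

lemma measurable_setCoord (j₀ : Fin p) :
    Measurable fun z : EuclideanSpace ℝ (Fin p) × ℝ => setCoord j₀ z.1 z.2 := by
  unfold setCoord
  fun_prop

lemma setCoord_apply_self (j₀ : Fin p) (z : EuclideanSpace ℝ (Fin p)) (x : ℝ) :
    setCoord j₀ z x j₀ = x := by
  simp [setCoord]

lemma setCoord_apply_of_ne {j₀ j : Fin p} (h : j ≠ j₀) (z : EuclideanSpace ℝ (Fin p)) (x : ℝ) :
    setCoord j₀ z x j = z j := by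
  simp [setCoord, h]

lemma inner_setCoord {j₀ : Fin p} {u : EuclideanSpace ℝ (Fin p)} (hu : u j₀ = 0)
    (z : EuclideanSpace ℝ (Fin p)) (x : ℝ) : inner ℝ u (setCoord j₀ z x) = inner ℝ u z := by
  simp [setCoord, inner_add_right, real_inner_smul_right, EuclideanSpace.inner_single_right, hu]

/-- The covariate law under which all coordinates have variance `τ²` and the coordinate `j₀` has
correlation `ρ` with the projection of the others in the direction `u`, `w² = 1 - ρ²`. -/
noncomputable def spikedLaw (j₀ : Fin p) (u : EuclideanSpace ℝ (Fin p)) (τ ρ w : ℝ) :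
    Measure (EuclideanSpace ℝ (Fin p)) :=
  ((stdGaussian (EuclideanSpace ℝ (Fin p))).prod (gaussianReal 0 1)).map
    fun z => τ • setCoord j₀ z.1 (ρ * inner ℝ u z.1 + w * z.2)

lemma measurable_spiked (j₀ : Fin p) (u : EuclideanSpace ℝ (Fin p)) (τ ρ w : ℝ) :
    Measurable fun z : EuclideanSpace ℝ (Fin p) × ℝ =>
      τ • setCoord j₀ z.1 (ρ * inner ℝ u z.1 + w * z.2) :=
  ((measurable_setCoord j₀).comp (by fun_prop : Measurable fun z : EuclideanSpace ℝ (Fin p) × ℝ =>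
    (z.1, ρ * inner ℝ u z.1 + w * z.2))).const_smul τ

lemma spikedLaw_map_inner (j₀ : Fin p) (u : EuclideanSpace ℝ (Fin p)) (τ ρ w : ℝ)
    (x : EuclideanSpace ℝ (Fin p)) :
    (spikedLaw j₀ u τ ρ w).map (fun y => inner ℝ x y) = gaussianReal 0
      (‖τ • (x + (ρ * x j₀) • u - x j₀ • EuclideanSpace.single j₀ (1 : ℝ))‖₊ ^ 2
        + ‖τ * w * x j₀‖₊ ^ 2) := by
  unfold spikedLaw
  rw [Measure.map_map (by fun_prop) (measurable_spiked j₀ u τ ρ w),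
    ← stdGaussian_prod_map_inner_add]
  congr 1
  ext z
  simp only [Function.comp, setCoord, inner_add_right, real_inner_smul_right,
    EuclideanSpace.inner_single_right, inner_add_left, inner_sub_left, real_inner_smul_left,
    EuclideanSpace.inner_single_left, conj_trivial]
  ring

instance isGaussian_spikedLaw (j₀ : Fin p) (u : EuclideanSpace ℝ (Fin p)) (τ ρ w : ℝ) :
    IsGaussian (spikedLaw j₀ u τ ρ w) := by
  refine isGaussian_of_map_eq_gaussianReal fun L => ?_
  have h : (L : EuclideanSpace ℝ (Fin p) → ℝ)
      = fun y => inner ℝ ((InnerProductSpace.toDual ℝ (EuclideanSpace ℝ (Fin p))).symm L) y := by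
    ext y
    simp
  rw [h]
  exact ⟨0, _, spikedLaw_map_inner j₀ u τ ρ w _⟩

lemma spikedLaw_variance {j₀ : Fin p} {u : EuclideanSpace ℝ (Fin p)} (hu0 : u j₀ = 0)
    (hu : ‖u‖ = 1) (τ : ℝ) {ρ w : ℝ} (hw : ρ ^ 2 + w ^ 2 = 1) (x : EuclideanSpace ℝ (Fin p)) :
    ((‖τ • (x + (ρ * x j₀) • u - x j₀ • EuclideanSpace.single j₀ (1 : ℝ))‖₊ ^ 2
      + ‖τ * w * x j₀‖₊ ^ 2 : ℝ≥0) : ℝ)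
      = τ ^ 2 * (‖x‖ ^ 2 + ρ * (2 * x j₀ * inner ℝ x u)) := by
  have h : ‖x + (ρ * x j₀) • u - x j₀ • EuclideanSpace.single j₀ (1 : ℝ)‖ ^ 2
      = ‖x‖ ^ 2 + 2 * ρ * x j₀ * inner ℝ x u + ρ ^ 2 * x j₀ ^ 2 - x j₀ ^ 2 := by
    rw [norm_sub_sq_real, norm_add_sq_real]
    simp only [inner_add_left, real_inner_smul_right,
      EuclideanSpace.inner_single_right, norm_smul, hu, conj_trivial, Real.norm_eq_abs,
      mul_pow, sq_abs, PiLp.norm_single, norm_one]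
    simp [hu0]
    ring
  push_cast
  rw [norm_smul, mul_pow, h, Real.norm_eq_abs, Real.norm_eq_abs, sq_abs,
    sq_abs]
  linear_combination (τ ^ 2 * x j₀ ^ 2) * hw

/-- Bessel's inequality for the orthonormal pair `e_{j₀}`, `u`, followed by the arithmetic-geometric
mean inequality. With `spikedLaw_variance` it places the variance in every unit direction between
`τ² (1 - |ρ|)` and `τ² (1 + |ρ|)`. -/
lemma abs_two_mul_apply_mul_inner_le {j₀ : Fin p} {u : EuclideanSpace ℝ (Fin p)} (hu0 : u j₀ = 0)
    (hu : ‖u‖ = 1) (x : EuclideanSpace ℝ (Fin p)) : |2 * x j₀ * inner ℝ x u| ≤ ‖x‖ ^ 2 := by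
  have h : ‖x - x j₀ • EuclideanSpace.single j₀ (1 : ℝ) - (inner ℝ x u : ℝ) • u‖ ^ 2
      = ‖x‖ ^ 2 - x j₀ ^ 2 - (inner ℝ x u) ^ 2 := by
    rw [norm_sub_sq_real, norm_sub_sq_real]
    simp only [inner_sub_left, real_inner_smul_right, real_inner_smul_left,
      EuclideanSpace.inner_single_right, EuclideanSpace.inner_single_left, hu0, norm_smul, hu,
      conj_trivial, Real.norm_eq_abs, mul_pow, sq_abs, PiLp.norm_single, norm_one]
    simp
    ring
  have h0 := sq_nonneg ‖x - x j₀ • EuclideanSpace.single j₀ (1 : ℝ) - (inner ℝ x u : ℝ) • u‖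
  rw [abs_le]
  constructor
  · nlinarith [sq_nonneg (x j₀ + inner ℝ x u)]
  · nlinarith [sq_nonneg (x j₀ - inner ℝ x u)]

/-- Covariates with a hidden correlation between the coordinate `j₀` and a sparse direction, and a
regression coefficient for which the response is independent of the other coordinates. -/
noncomputable def spikedMechanism (ι : Fin q × Fin m ↪ Fin p) (j₀ : Fin p) (τ ρ w b : ℝ)
    (σ : ℝ≥0) (f : Fin q → Fin m) : Mechanism p :=
  Mechanism.gaussian (spikedLaw j₀ (sparseDir ι f) τ ρ w)
    (b • (EuclideanSpace.single j₀ 1 - ρ • sparseDir ι f)) σ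

/-- The covariates and the response as a function of the standard Gaussian variables. -/
noncomputable def spikedMap (j₀ : Fin p) (u : EuclideanSpace ℝ (Fin p)) (τ ρ w b : ℝ) (σ : ℝ≥0)
    (z : EuclideanSpace ℝ (Fin p) × (ℝ × ℝ)) : EuclideanSpace ℝ (Fin p) × ℝ :=
  (τ • setCoord j₀ z.1 (ρ * inner ℝ u z.1 + w * z.2.1), b * τ * w * z.2.1 + σ * z.2.2)

lemma measurable_spikedMap (j₀ : Fin p) (u : EuclideanSpace ℝ (Fin p)) (τ ρ w b : ℝ) (σ : ℝ≥0) :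
    Measurable (spikedMap j₀ u τ ρ w b σ) :=
  ((measurable_spiked j₀ u τ ρ w).comp
    (by fun_prop : Measurable fun z : EuclideanSpace ℝ (Fin p) × (ℝ × ℝ) => (z.1, z.2.1))).prodMk
    (by fun_prop)

/-- The choice of `β` cancels the part of `X_{j₀}` along `u`, leaving a response built from `z.2`
alone: the innovation `z.2.1` of that coordinate and the noise `z.2.2`. -/
lemma spikedMechanism_law (ι : Fin q × Fin m ↪ Fin p) {j₀ : Fin p} (hj₀ : j₀ ∉ Set.range ι)
    (τ ρ w b : ℝ) (σ : ℝ≥0) (f : Fin q → Fin m) :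
    (spikedMechanism ι j₀ τ ρ w b σ f).law
      = ((stdGaussian (EuclideanSpace ℝ (Fin p))).prod
          ((gaussianReal 0 1).prod (gaussianReal 0 1))).map
        (spikedMap j₀ (sparseDir ι f) τ ρ w b σ) := by
  set u := sparseDir ι f
  have hu0 : u j₀ = 0 := sparseDir_apply_eq_zero ι f hj₀
  show ((spikedLaw j₀ u τ ρ w).prod (gaussianReal 0 1)).map (response _ σ) = _
  have h : (spikedLaw j₀ u τ ρ w).prod (gaussianReal 0 1)
      = (((stdGaussian (EuclideanSpace ℝ (Fin p))).prod (gaussianReal 0 1)).prod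
          (gaussianReal 0 1)).map
        (Prod.map (fun z => τ • setCoord j₀ z.1 (ρ * inner ℝ u z.1 + w * z.2)) id) := by
    rw [← Measure.map_prod_map _ _ (measurable_spiked j₀ u τ ρ w) measurable_id, Measure.map_id]
    rfl
  rw [h, Measure.map_map (measurable_response _ _)
    ((measurable_spiked j₀ u τ ρ w).prodMap measurable_id), ← Measure.prodAssoc_prod,
    Measure.map_map (measurable_spikedMap j₀ u τ ρ w b σ) (MeasurableEquiv.measurable _)]
  congr 1
  ext ⟨⟨z, ξ⟩, η⟩
  · rfl
  · show (∑ j, (τ • setCoord j₀ z (ρ * inner ℝ u z + w * ξ)) j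
      * (b • (EuclideanSpace.single j₀ (1 : ℝ) - ρ • u) : EuclideanSpace ℝ (Fin p)) j) + σ * η = b * τ * w * ξ + σ * η
    have e : ∀ x y : EuclideanSpace ℝ (Fin p), ∑ j, x j * y j = inner ℝ y x := by
      intro x y
      simp [PiLp.inner_apply]
    rw [e, real_inner_smul_left, real_inner_smul_right, inner_sub_left, real_inner_smul_left,
      inner_setCoord hu0, EuclideanSpace.inner_single_left, setCoord_apply_self]
    simp
    ring

lemma spikedMechanism_law_map_fst (ι : Fin q × Fin m ↪ Fin p) (j₀ : Fin p) (τ ρ w b : ℝ)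
    (σ : ℝ≥0) (f : Fin q → Fin m) :
    (spikedMechanism ι j₀ τ ρ w b σ f).law.map Prod.fst = spikedLaw j₀ (sparseDir ι f) τ ρ w := by
  show (((spikedLaw j₀ _ τ ρ w).prod (gaussianReal 0 1)).map (response _ σ)).map Prod.fst = _
  rw [Measure.map_map measurable_fst (measurable_response _ σ),
    show Prod.fst ∘ response (b • (EuclideanSpace.single j₀ 1 - ρ • sparseDir ι f)) σ = Prod.fst
      from rfl, Measure.map_fst_prod]
  simp

/-- With `τ² = 9 RX² / 32` and `ρ ≤ 1 / 3`, the directional variances lie between `τ² · 2/3 = 3 RX²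
/ 16` and `τ² · 4/3 = 3 RX² / 8`: the bounds required for the restricted eigenvalue and the
sub-Gaussian norm. The coefficient has one nonzero entry at `j₀` besides the `q` sparse ones. -/
lemma spikedMechanism_inHD (hq : 0 < q) (ι : Fin q × Fin m ↪ Fin p) {j₀ : Fin p}
    (hj₀ : j₀ ∉ Set.range ι) {τ ρ w b RX R B Φ : ℝ} {s : ℕ} (hRX : 0 < RX) (hR : 0 ≤ R)
    (hΦ : 0 ≤ Φ) (hΦ' : Φ ≤ 3 * RX ^ 2 / 16) (hτ : τ ^ 2 = 9 * RX ^ 2 / 32) (hρ : 0 ≤ ρ)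
    (hρ' : ρ ≤ 1 / 3) (hw : ρ ^ 2 + w ^ 2 = 1) (hb : 0 ≤ b) (hbB : 2 * b ≤ B) (hqs : q + 1 ≤ s)
    (f : Fin q → Fin m) :
    InHD RX R B s Φ (spikedMechanism ι j₀ τ ρ w b R.toNNReal f) := by
  have hu := norm_sparseDir hq ι f
  have hu0 := sparseDir_apply_eq_zero ι f hj₀
  refine inHD_gaussian hRX hΦ (fun x => ⟨_, spikedLaw_map_inner j₀ _ τ ρ w x, ?_, ?_⟩) ?_ ?_ ?_
  · rw [spikedLaw_variance hu0 hu τ hw, hτ]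
    have h := abs_le.1 (abs_two_mul_apply_mul_inner_le hu0 hu x)
    have h1 : -(1 / 3 * ‖x‖ ^ 2) ≤ ρ * (2 * x j₀ * inner ℝ x (sparseDir ι f)) := by
      nlinarith [sq_nonneg ‖x‖]
    calc Φ * ‖x‖ ^ 2 ≤ 3 * RX ^ 2 / 16 * ‖x‖ ^ 2 := by gcongr
      _ = 9 * RX ^ 2 / 32 * (‖x‖ ^ 2 + -(1 / 3 * ‖x‖ ^ 2)) := by ring
      _ ≤ _ := by gcongr
  · rw [spikedLaw_variance hu0 hu τ hw, hτ]
    have h := abs_le.1 (abs_two_mul_apply_mul_inner_le hu0 hu x)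
    have h1 : ρ * (2 * x j₀ * inner ℝ x (sparseDir ι f)) ≤ 1 / 3 * ‖x‖ ^ 2 := by
      nlinarith [sq_nonneg ‖x‖]
    calc _ ≤ 9 * RX ^ 2 / 32 * (‖x‖ ^ 2 + 1 / 3 * ‖x‖ ^ 2) := by gcongr
      _ = _ := by ring
  · refine (Finset.card_le_card (t := insert j₀ (Finset.univ.image fun i => ι (i, f i)))
      fun j hj => ?_).trans ((Finset.card_insert_le _ _).trans
        ((Nat.add_le_add_right (card_image_sparse_le ι f) 1).trans hqs))
    rw [Finset.mem_insert]
    by_cases hjj : j = j₀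
    · exact Or.inl hjj
    · refine Or.inr (sparseDir_support_subset ι f fun h => (Finset.mem_filter.1 hj).2 ?_)
      simp [h, hjj]
  · rw [norm_smul, Real.norm_of_nonneg hb]
    have h1 : ‖EuclideanSpace.single j₀ (1 : ℝ) - ρ • sparseDir ι f‖ ≤ 2 := by
      refine (norm_sub_le _ _).trans ?_
      rw [norm_smul, hu, PiLp.norm_single, norm_one, Real.norm_of_nonneg hρ]
      linarith
    nlinarith
  · rw [Real.coe_toNNReal _ hR]

lemma spikedLaw_chiSqDominated (hq : 0 < q) (ι : Fin q × Fin m ↪ Fin p) (j₀ : Fin p) (τ : ℝ)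
    {ρ w : ℝ} (hw0 : 0 < w) (hw : ρ ^ 2 + w ^ 2 = 1) (f : Fin q → Fin m) :
    ChiSqDominated (spikedLaw j₀ (sparseDir ι f) τ ρ w)
      (((stdGaussian (EuclideanSpace ℝ (Fin p))).prod (gaussianReal 0 1)).map
        fun z => τ • setCoord j₀ z.1 z.2) (ENNReal.ofReal (w ^ 2)⁻¹) := by
  have hm : Measurable fun z : EuclideanSpace ℝ (Fin p) × ℝ => τ • setCoord j₀ z.1 z.2 :=
    (measurable_setCoord j₀).const_smul τ
  have h := (chiSqDominated_spike (norm_sparseDir hq ι f) hw0 hw).map hm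
  rwa [Measure.map_map hm (by fun_prop)] at h

/-- The law of a fully observed labelled observation is dominated by a law which does not depend
on the sparse direction. -/
lemma exists_spikedMechanism_chiSqDominated (hq : 0 < q) (ι : Fin q × Fin m ↪ Fin p) {j₀ : Fin p}
    (hj₀ : j₀ ∉ Set.range ι) (τ b : ℝ) {ρ w : ℝ} (hw0 : 0 < w) (hw : ρ ^ 2 + w ^ 2 = 1)
    {σ : ℝ≥0} (hσ : 0 < σ) :
    ∃ Q : Measure (EuclideanSpace ℝ (Fin p) × ℝ), IsProbabilityMeasure Q ∧
      ∀ f : Fin q → Fin m, ChiSqDominated (spikedMechanism ι j₀ τ ρ w b σ f).law Q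
        (ENNReal.ofReal ((1 + ρ ^ 2 * (b * τ * w / σ) ^ 2) / w ^ 2)) := by
  have hσ' : (0 : ℝ) < σ := hσ
  set κ := b * τ * w / σ with hκ
  set S := √(1 + κ ^ 2) with hS
  have hS2 : S ^ 2 = 1 + κ ^ 2 := Real.sq_sqrt (by positivity)
  have hSpos : 0 < S := Real.sqrt_pos.2 (by positivity)
  -- `V²` is the variance of the `j₀` coordinate (before scaling by `τ`) once the component
  -- explained by the response is removed. The remainder has correlation `ρ / V` with the direction.
  set V := √(ρ ^ 2 + (w / S) ^ 2) with hV
  have hV2 : V ^ 2 = ρ ^ 2 + (w / S) ^ 2 := Real.sq_sqrt (by positivity)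
  have hVpos : 0 < V := Real.sqrt_pos.2 (by positivity)
  let F : (EuclideanSpace ℝ (Fin p) × ℝ) × ℝ → EuclideanSpace ℝ (Fin p) × ℝ := fun z =>
    (τ • setCoord j₀ z.1.1 (V * z.1.2 + w * κ / S * z.2), σ * S * z.2)
  have hF : Measurable F :=
    (((measurable_setCoord j₀).comp (by fun_prop : Measurable
      fun z : (EuclideanSpace ℝ (Fin p) × ℝ) × ℝ =>
        (z.1.1, V * z.1.2 + w * κ / S * z.2))).const_smul τ).prodMk (by fun_prop)
  refine ⟨(((stdGaussian (EuclideanSpace ℝ (Fin p))).prod (gaussianReal 0 1)).prod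
    (gaussianReal 0 1)).map F, Measure.isProbabilityMeasure_map hF.aemeasurable, fun f => ?_⟩
  set u := sparseDir ι f
  have hspike := chiSqDominated_spike (norm_sparseDir hq ι f) (r := ρ / V) (w := w / S / V)
    (by positivity) (by rw [div_pow, div_pow, ← add_div, ← hV2, div_self (by positivity)])
  have h := (hspike.prod (ChiSqDominated.refl (gaussianReal 0 1))).map hF
  have hc : ((w / S / V) ^ 2)⁻¹ = (1 + ρ ^ 2 * κ ^ 2) / w ^ 2 := by
    rw [div_pow, hV2, div_pow, hS2, show w ^ 2 = 1 - ρ ^ 2 by linarith]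
    have h1 : 1 - ρ ^ 2 ≠ 0 := by nlinarith
    field_simp
    ring
  rw [mul_one, hc] at h
  convert h using 1
  -- Rotating innovation and noise makes the response a multiple of the second new variable, so the
  -- spike lemma applies with that variable as an independent bystander.
  have hrot : (stdGaussian (EuclideanSpace ℝ (Fin p))).prod
      ((gaussianReal 0 1).prod (gaussianReal 0 1))
      = ((stdGaussian (EuclideanSpace ℝ (Fin p))).prod
        ((gaussianReal 0 1).prod (gaussianReal 0 1))).map
        (Prod.map id fun x : ℝ × ℝ => ((x.1 - κ * x.2) / S, (κ * x.1 + x.2) / S)) := by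
    rw [← Measure.map_prod_map _ _ measurable_id (by fun_prop), Measure.map_id, hS,
      gaussianReal_prod_map_rotation]
  let H : EuclideanSpace ℝ (Fin p) × (ℝ × ℝ) → EuclideanSpace ℝ (Fin p) × ℝ := fun z =>
    (τ • setCoord j₀ z.1 (ρ * inner ℝ u z.1 + w / S * z.2.1 + w * κ / S * z.2.2),
      σ * S * z.2.2)
  have hH : Measurable H :=
    (((measurable_setCoord j₀).comp (by fun_prop : Measurable
      fun z : EuclideanSpace ℝ (Fin p) × (ℝ × ℝ) =>
        (z.1, ρ * inner ℝ u z.1 + w / S * z.2.1 + w * κ / S * z.2.2))).const_smul τ).prodMk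
      (by fun_prop)
  have hGH : spikedMap j₀ u τ ρ w b σ
      = H ∘ Prod.map id fun x : ℝ × ℝ => ((x.1 - κ * x.2) / S, (κ * x.1 + x.2) / S) := by
    ext1 ⟨z, ξ, η⟩
    have e1 : w / S * ((ξ - κ * η) / S) + w * κ / S * ((κ * ξ + η) / S) = w * ξ := by
      have : w / S * ((ξ - κ * η) / S) + w * κ / S * ((κ * ξ + η) / S)
          = w * ξ * (1 + κ ^ 2) / S ^ 2 := by
        field_simp
        ring
      rw [this, hS2]
      field_simp
    have e2 : σ * S * ((κ * ξ + η) / S) = b * τ * w * ξ + σ * η := by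
      rw [hκ]
      field_simp
    simp only [spikedMap, H, Function.comp, Prod.map, id, add_assoc, e1, e2]
  rw [spikedMechanism_law ι hj₀, hGH, ← Measure.map_map hH (by fun_prop), ← hrot,
    ← Measure.prodAssoc_prod, Measure.map_map hH (MeasurableEquiv.measurable _)]
  have hprod : (((stdGaussian (EuclideanSpace ℝ (Fin p))).prod (gaussianReal 0 1)).map
      fun z => (z.1, ρ / V * inner ℝ u z.1 + w / S / V * z.2)).prod (gaussianReal 0 1)
      = (((stdGaussian (EuclideanSpace ℝ (Fin p))).prod (gaussianReal 0 1)).prod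
        (gaussianReal 0 1)).map
        (Prod.map (fun z => (z.1, ρ / V * inner ℝ u z.1 + w / S / V * z.2)) id) := by
    rw [← Measure.map_prod_map _ _ (by fun_prop) measurable_id, Measure.map_id]
  rw [hprod, Measure.map_map hF (by fun_prop)]
  congr 1
  ext1 ⟨⟨z, ζ⟩, ζ'⟩
  have e : V * (ρ / V * inner ℝ u z + w / S / V * ζ) = ρ * inner ℝ u z + w / S * ζ := by
    field_simp
  simp only [F, H, Function.comp, Prod.map, id, MeasurableEquiv.prodAssoc, MeasurableEquiv.coe_mk,
    Equiv.prodAssoc_apply, e]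

theorem crossModality_bound (D : Design) {RX R B Φ : ℝ} {s : ℕ} (hRX : 0 < RX) (hR : 0 < R)
    (hB : 0 < B) (hΦ : 0 < Φ) (hΦ' : Φ ≤ 3 * RX ^ 2 / 16) (hq : 0 < q) (hqs : q + 1 ≤ s)
    (hm : 4096 ≤ m) (g h : Fin D.L) (hcard : q * m ≤ (D.block h).card - 1) {ρ Λ : ℝ}
    (hρ : 0 < ρ) (hρ' : ρ ≤ 1 / 3) (hΛ : Real.exp Λ ≤ m)
    (hχ : ((D.crossN g h : ℝ) + D.N) *
      (ρ ^ 2 * (9 / 8 + B ^ 2 / 4 * (9 * RX ^ 2 / 32) / R ^ 2)) ≤ q * Λ / 4) :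
    ENNReal.ofReal ((B / 2 * ρ) ^ 2 / 8) ≤ D.minimaxRisk RX R B s Φ := by
  obtain ⟨j₀, hj₀⟩ := D.compatible.nonempty g
  obtain ⟨ι, hι⟩ := exists_embedding_into (A := (D.block h).erase j₀)
    (hcard.trans Finset.pred_card_le_card_erase)
  have hιh : Set.range ι ⊆ D.block h := hι.trans (by exact_mod_cast Finset.erase_subset _ _)
  have hj₀' : j₀ ∉ Set.range ι := fun hmem => Finset.notMem_erase j₀ _ (hι hmem)
  have hR' : 0 < R.toNNReal := Real.toNNReal_pos.2 hR
  have hRc : ((R.toNNReal : ℝ≥0) : ℝ) = R := Real.coe_toNNReal R hR.le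
  set b := B / 2 with hb
  have hbpos : 0 < b := by positivity
  set τ := √(9 * RX ^ 2 / 32) with hτ
  have hτ2 : τ ^ 2 = 9 * RX ^ 2 / 32 := Real.sq_sqrt (by positivity)
  set w := √(1 - ρ ^ 2) with hwdef
  have hρ2 : ρ ^ 2 ≤ 1 / 9 := by nlinarith
  have hw2 : w ^ 2 = 1 - ρ ^ 2 := Real.sq_sqrt (by linarith)
  have hw0 : 0 < w := Real.sqrt_pos.2 (by linarith)
  have hw : ρ ^ 2 + w ^ 2 = 1 := by linarith
  set P := spikedMechanism ι j₀ τ ρ w b R.toNNReal with hPdef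
  let f₀ : Fin q → Fin m := fun _ => ⟨0, by omega⟩
  obtain ⟨Q₀, hQ₀, hQ₀dom⟩ := exists_spikedMechanism_chiSqDominated (m := m) hq ι hj₀' τ b hw0 hw hR'
  let Q' := ((stdGaussian (EuclideanSpace ℝ (Fin D.p))).prod (gaussianReal 0 1)).map
        fun z => τ • setCoord j₀ z.1 z.2
  have hQ' : IsProbabilityMeasure Q' := Measure.isProbabilityMeasure_map
    ((measurable_setCoord j₀).const_smul τ).aemeasurable
  let Q : (k : Fin D.K) → Measure ((D.O k → ℝ) × ℝ) := fun k =>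
    if D.block g ∪ D.block h ⊆ D.O k then Q₀.map (D.obs k) else (P f₀).law.map (D.obs k)
  have hQ : ∀ k, IsProbabilityMeasure (Q k) := by
    intro k
    by_cases hk : D.block g ∪ D.block h ⊆ D.O k <;> simp only [Q, hk, if_true, if_false] <;>
      infer_instance
  set x := (1 + ρ ^ 2 * (b * τ * w / R) ^ 2) / w ^ 2 with hx
  have hx0 : 0 ≤ x := by positivity
  have hwinv : (w ^ 2)⁻¹ ≤ x := by
    rw [hx, inv_eq_one_div]
    gcongr
    nlinarith [mul_nonneg (sq_nonneg ρ) (sq_nonneg (b * τ * w / R))]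
  have hxle : x ≤ Real.exp (ρ ^ 2 * (9 / 8 + B ^ 2 / 4 * (9 * RX ^ 2 / 32) / R ^ 2)) := by
    refine le_trans ?_ (Real.add_one_le_exp _)
    have e : x = 1 / w ^ 2 + ρ ^ 2 * (B ^ 2 / 4 * (9 * RX ^ 2 / 32) / R ^ 2) := by
      rw [hx, div_pow, mul_pow, mul_pow, hτ2, hb]
      field_simp
      ring
    -- Valid precisely for `ρ² ≤ 1 / 9`, with equality at the endpoint; this is the origin of `9 /
    -- 8`.
    have e1 : 1 / w ^ 2 ≤ 1 + ρ ^ 2 * (9 / 8) := by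
      rw [hw2, div_le_iff₀ (by linarith)]
      nlinarith [sq_nonneg ρ]
    rw [e]
    linarith
  refine le_minimaxRisk_of_chiSqDominated D hq hm P
    (fun f => spikedMechanism_inHD hq ι hj₀' hRX hR.le hΦ.le hΦ' hτ2 hρ.le hρ' hw hbpos.le
      (by rw [hb]; linarith) hqs f)
    (D.productLaw Q Q') (χ := x ^ D.crossN g h * x ^ D.N) ?_ ?_ (mul_pos hbpos hρ) ?_
  · refine le_trans ?_ (exp_le_sqrt_rpow (by omega) hΛ)
    rw [← pow_add]
    calc x ^ (D.crossN g h + D.N) ≤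
          Real.exp (ρ ^ 2 * (9 / 8 + B ^ 2 / 4 * (9 * RX ^ 2 / 32) / R ^ 2))
            ^ (D.crossN g h + D.N) := by gcongr
      _ = Real.exp (((D.crossN g h : ℝ) + D.N) *
          (ρ ^ 2 * (9 / 8 + B ^ 2 / 4 * (9 * RX ^ 2 / 32) / R ^ 2))) := by
          rw [← Real.exp_nat_mul]; push_cast; rfl
      _ ≤ _ := Real.exp_le_exp.2 hχ
  · intro f
    have hdom := D.chiSqDominated_dataLaw (P f) (Q := Q) (Q' := Q')
      (fun k => D.block g ∪ D.block h ⊆ D.O k) (c := ENNReal.ofReal x) (c' := ENNReal.ofReal x)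
      ?_ ?_ ?_
    · refine hdom.mono (le_of_eq ?_)
      rw [ENNReal.ofReal_mul (by positivity), ENNReal.ofReal_pow hx0, ENNReal.ofReal_pow hx0]
      rfl
    · intro k hk
      have := (hQ₀dom f).map (D.measurable_obs k)
      rw [hRc] at this
      simp only [Q, hk, if_true]
      exact this
    · intro k hk
      simp only [Q, hk, if_false, hPdef, spikedMechanism_law ι hj₀']
      rw [Measure.map_map (D.measurable_obs k) (measurable_spikedMap _ _ _ _ _ _ _),
        Measure.map_map (D.measurable_obs k) (measurable_spikedMap _ _ _ _ _ _ _)]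
      -- If `j₀` is seen, so is modality `g`, hence `h` is missed and the permutation argument
      -- applies. If `j₀` is unseen, the recorded variables do not involve `f` at all.
      by_cases hjk : j₀ ∈ D.O k
      · have hgk : D.block g ⊆ D.O k := (D.block_subset_or_disjoint g k).resolve_right
          fun hd => Finset.disjoint_left.1 hd hj₀ hjk
        have hdisj := (D.block_subset_or_disjoint h k).resolve_left
          fun hhk => hk (Finset.union_subset hgk hhk)
        obtain ⟨U, hU1, hU2⟩ := exists_isometry_sparseDir ι f f₀
        refine stdGaussian_prod_map_eq_of_isometry _ U
          ((D.measurable_obs k).comp (measurable_spikedMap _ _ _ _ _ _ _)) fun z e => ?_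
        simp only [Function.comp, Design.obs, spikedMap, hU2]
        congr 1
        ext j
        simp only [PiLp.smul_apply]
        congr 1
        by_cases hj : (j : Fin D.p) = j₀
        · rw [hj, setCoord_apply_self, setCoord_apply_self]
        · rw [setCoord_apply_of_ne hj, setCoord_apply_of_ne hj]
          exact hU1 z j fun hmem => Finset.disjoint_left.1 hdisj (hιh hmem) j.2
      · congr 1
        ext1 z
        simp only [Function.comp, Design.obs, spikedMap]
        congr 1
        ext j
        have hj : (j : Fin D.p) ≠ j₀ := fun hj => hjk (hj ▸ j.2)
        simp only [PiLp.smul_apply, setCoord_apply_of_ne hj]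
    · rw [hPdef, spikedMechanism_law_map_fst]
      exact (spikedLaw_chiSqDominated hq ι j₀ τ hw0 hw f).mono (ENNReal.ofReal_le_ofReal hwinv)
  · intro f f'
    refine le_of_eq ?_
    show _ = ‖b • (EuclideanSpace.single j₀ (1 : ℝ) - ρ • sparseDir ι f)
      - b • (EuclideanSpace.single j₀ (1 : ℝ) - ρ • sparseDir ι f')‖ ^ 2
    rw [← smul_sub, sub_sub_sub_cancel_left, ← smul_sub, smul_smul, norm_smul, mul_pow, mul_pow,
      norm_sub_rev, norm_sparseDir_sub_sq hq, Real.norm_eq_abs, sq_abs, mul_pow]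

end CrossModality

/-! ### The two terms of the lower bound -/

lemma min_one_div_mul_le (x y : ℝ) (hy : 0 < y) : min 1 (x / y) * y = min y x := by
  rw [min_mul_of_nonneg _ _ hy.le, one_mul, div_mul_cancel₀ _ hy.ne']

theorem minimaxRisk_ge_singleModality (D : Design) {RX R B Φ : ℝ} {s : ℕ} (hRX : 0 < RX)
    (hR : 0 < R) (hB : 0 < B) (hΦ : 0 < Φ) (hΦ' : Φ ≤ 3 * RX ^ 2 / 16) (hs : 2 ≤ s)
    (l : Fin D.L) (hsl : 10000 * s ≤ (D.block l).card)
    (hbound : R ^ 2 * (s : ℝ) * Real.log (1 + ((D.block l).card : ℝ) / (2 * (s : ℝ)))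
      / (16 * B ^ 2 * Φ * (D.h l : ℝ)) ≤ 1) :
    ENNReal.ofReal (R ^ 2 * (s : ℝ) / (2 ^ 10 * (D.h l : ℝ) * Φ)
      * Real.log (1 + ((D.block l).card : ℝ) / (2 * (s : ℝ)))) ≤ D.minimaxRisk RX R B s Φ := by
  set T := (D.block l).card
  have hs0 : 0 < s := by omega
  have hsR : (0 : ℝ) < s := by exact_mod_cast hs0
  have hh : (0 : ℝ) < D.h l := by exact_mod_cast D.h_pos l
  have hT : (10000 : ℝ) * s ≤ T := by exact_mod_cast hsl
  set Λ := Real.log (1 + (T : ℝ) / (2 * (s : ℝ))) with hΛdef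
  have harg : 1 < 1 + (T : ℝ) / (2 * (s : ℝ)) := by
    have : 0 < (T : ℝ) / (2 * (s : ℝ)) := div_pos (by linarith) (by positivity)
    linarith
  have hΛ : 0 < Λ := Real.log_pos harg
  have hm : 4096 ≤ T / s := (Nat.le_div_iff_mul_le hs0).2 (by omega)
  -- The factor `1 / 2` in the logarithm absorbs the loss from rounding `T / s` down.
  have hexp : Real.exp Λ ≤ (T / s : ℕ) := by
    rw [hΛdef, Real.exp_log (by linarith)]
    have h1 : (T : ℝ) ≤ s * ((T / s : ℕ) + 1) := by
      have := (Nat.lt_mul_div_succ T hs0).le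
      exact_mod_cast this
    have h2 : (4096 : ℝ) ≤ (T / s : ℕ) := by exact_mod_cast hm
    have h3 : (T : ℝ) / (2 * s) ≤ ((T / s : ℕ) + 1) / 2 := by
      rw [div_le_div_iff₀ (by positivity) (by norm_num)]
      linarith
    linarith
  -- With this separation `d ≤ B` is exactly the assumed bound, the chi-square exponent is `s Λ /
  -- 16`, and `d² / 8` exceeds the claim by a factor `8`.
  set d := √(R ^ 2 * s * Λ / (16 * Φ * D.h l)) with hd
  have hd2 : d ^ 2 = R ^ 2 * s * Λ / (16 * Φ * D.h l) := Real.sq_sqrt (by positivity)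
  have hdpos : 0 < d := Real.sqrt_pos.2 (by positivity)
  refine le_trans (ENNReal.ofReal_le_ofReal ?_) (singleModality_bound D hRX hR hΦ
    (by nlinarith [sq_nonneg RX]) hs0 hm l (Nat.mul_div_le T s) (d := d) (Λ := Λ) hdpos ?_ hexp ?_)
  · rw [hd2]
    have e : R ^ 2 * s * Λ / (16 * Φ * D.h l) / 8
        = 8 * (R ^ 2 * s / (2 ^ 10 * D.h l * Φ) * Λ) := by
      field_simp
      norm_num
    rw [e]
    have : 0 ≤ R ^ 2 * s / (2 ^ 10 * D.h l * Φ) * Λ := by positivity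
    linarith
  · refine abs_le_of_sq_le_sq' ?_ hB.le |>.2
    rw [div_le_one (by positivity)] at hbound
    rw [hd2, div_le_iff₀ (by positivity)]
    linarith
  · rw [hd2]
    have e : D.h l * (Φ * (R ^ 2 * s * Λ / (16 * Φ * D.h l)) / R ^ 2) = s * Λ / 16 := by
      field_simp
    rw [e]
    have : 0 < s * Λ := by positivity
    linarith

theorem minimaxRisk_ge_crossModality (D : Design) {RX R B Φ : ℝ} {s : ℕ} (hRX : 0 < RX)
    (hR : 0 < R) (hB : 0 < B) (hΦ : 0 < Φ) (hΦ' : Φ ≤ 3 * RX ^ 2 / 16) (hs : 2 ≤ s)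
    (g h : Fin D.L) (hsl : 10000 * s ≤ (D.block h).card) (hn : 0 < D.crossN g h + D.N)
    (hbound : 16 * (s : ℝ) * Real.log (1 + ((D.block h).card : ℝ) / (2 * ((s : ℝ) - 1)))
        * min 1 (R ^ 2 / B ^ 2) * min 1 (1 / RX ^ 4)
        / (9 * ((D.crossN g h : ℝ) + (D.N : ℝ))) ≤ 1) :
    ENNReal.ofReal (min 1 (2 ^ 6 / (3 ^ 2 * RX ^ 4)) * min (B ^ 2) (R ^ 2) * (s : ℝ)
        * Real.log (1 + ((D.block h).card : ℝ) / (2 * ((s : ℝ) - 1)))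
        / (2 ^ 17 * ((D.crossN g h : ℝ) + (D.N : ℝ)))) ≤ D.minimaxRisk RX R B s Φ := by
  set T := (D.block h).card
  -- One unit of sparsity is spent on `j₀`, which explains `s - 1` in the logarithm.
  obtain ⟨q, rfl⟩ : ∃ q, s = q + 1 := ⟨s - 1, by omega⟩
  have hq0 : 0 < q := by omega
  have hqR : (1 : ℝ) ≤ q := by exact_mod_cast hq0
  set n : ℝ := (D.crossN g h : ℝ) + D.N with hndef
  have hn0 : 0 < n := by rw [hndef]; exact_mod_cast hn
  have hsq : ((q + 1 : ℕ) : ℝ) - 1 = q := by push_cast; ring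
  rw [hsq] at hbound ⊢
  have hT : (10000 : ℝ) * (q + 1) ≤ T := by exact_mod_cast hsl
  set Λ := Real.log (1 + (T : ℝ) / (2 * (q : ℝ))) with hΛdef
  have harg : 1 < 1 + (T : ℝ) / (2 * (q : ℝ)) := by
    have : 0 < (T : ℝ) / (2 * (q : ℝ)) := div_pos (by linarith) (by positivity)
    linarith
  have hΛ : 0 < Λ := Real.log_pos harg
  have hm : 4096 ≤ (T - 1) / q := (Nat.le_div_iff_mul_le hq0).2 (by omega)
  have hexp : Real.exp Λ ≤ ((T - 1) / q : ℕ) := by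
    rw [hΛdef, Real.exp_log (by linarith)]
    have h1 : (T : ℝ) ≤ q * (((T - 1) / q : ℕ) + 1) := by
      have := Nat.lt_mul_div_succ (T - 1) hq0
      have h' : T ≤ q * ((T - 1) / q + 1) := by omega
      exact_mod_cast h'
    have h2 : (4096 : ℝ) ≤ ((T - 1) / q : ℕ) := by exact_mod_cast hm
    have h3 : (T : ℝ) / (2 * q) ≤ (((T - 1) / q : ℕ) + 1) / 2 := by
      rw [div_le_div_iff₀ (by positivity) (by norm_num)]
      linarith
    linarith
  set S : ℝ := ((q + 1 : ℕ) : ℝ) with hS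
  have hS1 : S = q + 1 := by rw [hS]; push_cast; ring
  have hS0 : 0 < S := by linarith
  set a := min 1 (R ^ 2 / B ^ 2) with ha
  set c := min 1 (1 / RX ^ 4) with hc
  have ha0 : 0 < a := lt_min one_pos (by positivity)
  have hc0 : 0 < c := lt_min one_pos (by positivity)
  have ha1 : a ≤ 1 := min_le_left _ _
  have hc1 : c ≤ 1 := min_le_left _ _
  -- The assumed bound gives `ρ² ≤ 9 / 256`, below the required `1 / 9`. The factors `a` and `c`
  -- keep the signal-to-noise contribution to the exponent bounded.
  set ρ := √(S * Λ * a * c / (16 * n)) with hρ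
  have hρ2 : ρ ^ 2 = S * Λ * a * c / (16 * n) := Real.sq_sqrt (by positivity)
  have hρpos : 0 < ρ := Real.sqrt_pos.2 (by positivity)
  have haB : a * B ^ 2 = min (B ^ 2) (R ^ 2) := min_one_div_mul_le _ _ (by positivity)
  refine le_trans (ENNReal.ofReal_le_ofReal ?_) (crossModality_bound D hRX hR hB hΦ hΦ' hq0 le_rfl
    hm g h (Nat.mul_div_le (T - 1) q) (ρ := ρ) (Λ := Λ) hρpos ?_ hexp ?_)
  · have e : (B / 2 * ρ) ^ 2 / 8 = c * (a * B ^ 2) * S * Λ / (2 ^ 9 * n) := by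
      rw [mul_pow, hρ2]
      field_simp
      norm_num
    rw [e, haB]
    have hmin : min 1 (2 ^ 6 / (3 ^ 2 * RX ^ 4)) ≤ 2 ^ 8 * c := by
      rw [hc, mul_min_of_nonneg _ _ (by norm_num)]
      refine min_le_min (by norm_num) ?_
      rw [← mul_div_assoc, div_le_div_iff₀ (by positivity) (by positivity)]
      have : 0 < RX ^ 4 := by positivity
      linarith
    have hBR : 0 < min (B ^ 2) (R ^ 2) := lt_min (by positivity) (by positivity)
    calc min 1 (2 ^ 6 / (3 ^ 2 * RX ^ 4)) * min (B ^ 2) (R ^ 2) * S * Λ / (2 ^ 17 * n)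
        ≤ (2 ^ 8 * c) * min (B ^ 2) (R ^ 2) * S * Λ / (2 ^ 17 * n) := by gcongr
      _ = c * min (B ^ 2) (R ^ 2) * S * Λ / (2 ^ 9 * n) := by
        field_simp
  · refine abs_le_of_sq_le_sq' ?_ (by norm_num) |>.2
    rw [div_le_one (by positivity)] at hbound
    rw [hρ2, div_le_iff₀ (by positivity)]
    linarith
  · have haR : a * (B ^ 2 / R ^ 2) ≤ 1 := by
      rw [← mul_div_assoc, haB, div_le_one (by positivity)]
      exact min_le_right _ _
    have hcR : c * RX ^ 2 ≤ 1 := by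
      rcases le_total RX 1 with h1 | h1
      · exact mul_le_one₀ hc1 (by positivity) (pow_le_one₀ hRX.le h1)
      · calc c * RX ^ 2 ≤ 1 / RX ^ 4 * RX ^ 2 := by gcongr; exact min_le_right _ _
          _ = (RX ^ 2)⁻¹ := by field_simp
          _ ≤ 1 := inv_le_one_of_one_le₀ (one_le_pow₀ h1)
    have e : n * (ρ ^ 2 * (9 / 8 + B ^ 2 / 4 * (9 * RX ^ 2 / 32) / R ^ 2))
        = S * Λ / 16 * (9 / 8 * (a * c) + 9 / 128 * (a * (B ^ 2 / R ^ 2) * (c * RX ^ 2))) := by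
      rw [hρ2]
      field_simp
      ring
    rw [e]
    have h1 : a * c ≤ 1 := mul_le_one₀ ha1 hc0.le hc1
    have h2 : a * (B ^ 2 / R ^ 2) * (c * RX ^ 2) ≤ 1 := mul_le_one₀ haR (by positivity) hcR
    calc S * Λ / 16 * (9 / 8 * (a * c) + 9 / 128 * (a * (B ^ 2 / R ^ 2) * (c * RX ^ 2)))
        ≤ S * Λ / 16 * 2 := by
          gcongr
          linarith
      -- Passing from `s` to `q = s - 1` costs at most a factor `2` because `s ≥ 2`.
      _ ≤ (2 * q) * Λ / 16 * 2 := by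
          gcongr
          linarith
      _ = q * Λ / 4 := by ring

end BlockMissing

theorem mainTheorem9 :
    ∃ c₁ : ℝ, 0 < c₁ ∧
      ∀ (D : BlockMissing.Design) (RX R B Φ : ℝ) (s : ℕ),
        0 < RX → 0 < R → 0 < B → 0 < Φ → Φ ≤ 3 * RX ^ 2 / 16 →
        2 ≤ s → (∀ l, (s : ℝ) ≤ c₁ * ((D.block l).card : ℝ)) →
        (∀ g h, 0 < D.crossN g h + D.N) →
        (∀ g h,
          16 * (s : ℝ) * Real.log (1 + ((D.block h).card : ℝ) / (2 * ((s : ℝ) - 1)))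
              * min 1 (R ^ 2 / B ^ 2) * min 1 (1 / RX ^ 4)
            / (9 * ((D.crossN g h : ℝ) + (D.N : ℝ))) ≤ 1) →
        (∀ i,
          R ^ 2 * (s : ℝ) * Real.log (1 + ((D.block i).card : ℝ) / (2 * (s : ℝ)))
            / (16 * B ^ 2 * Φ * (D.h i : ℝ)) ≤ 1) →
        max
          (⨆ h, ENNReal.ofReal
            (min 1 (2 ^ 6 / (3 ^ 2 * RX ^ 4)) * min (B ^ 2) (R ^ 2) * (s : ℝ)
                * Real.log (1 + ((D.block h).card : ℝ) / (2 * ((s : ℝ) - 1)))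
              / (2 ^ 17 * ((⨅ g, (D.crossN g h + D.N) : ℕ) : ℝ))))
          (⨆ l, ENNReal.ofReal
            (R ^ 2 * (s : ℝ) / (2 ^ 10 * (D.h l : ℝ) * Φ)
              * Real.log (1 + ((D.block l).card : ℝ) / (2 * (s : ℝ)))))
        ≤ D.minimaxRisk RX R B s Φ := by
  -- Any constant leaving at least `4096` coordinates per group, after removal of `j₀`, would serve.
  refine ⟨1 / 10000, by norm_num, fun D RX R B Φ s hRX hR hB hΦ hΦ' hs hcard hn hcross hsingle =>
    max_le (iSup_le fun h => ?_) (iSup_le fun l => ?_)⟩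
  all_goals
    have hcard' : ∀ l, 10000 * s ≤ (D.block l).card := fun l => by
      have : (10000 * s : ℝ) ≤ (D.block l).card := by linarith [hcard l]
      exact_mod_cast this
  · have : Nonempty (Fin D.L) := ⟨h⟩
    -- The infimum of natural numbers over a nonempty index set is attained, so the bound for a
    -- single minimising `g` is enough.
    obtain ⟨g, hg⟩ := ciInf_mem fun g => D.crossN g h + D.N
    simp only at hg
    rw [← hg, Nat.cast_add]
    exact BlockMissing.minimaxRisk_ge_crossModality D hRX hR hB hΦ hΦ' hs g h (hcard' h) (hn g h)
      (hcross g h)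
  · exact BlockMissing.minimaxRisk_ge_singleModality D hRX hR hB hΦ hΦ' hs l (hcard' l) (hsingle l)
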